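/- **Setting.** Let $X$ be a random loss on a probability space $(\Omega,\mathcal F,\mathbb P)$ with values in $[0,M]$, $M>0$. For a random variable $Y\ge 0$ put $F_Y^{-1}(t)=\inf\{x\ge 0:\mathbb P(Y\le x)\ge t\}$, $t\in[0,1]$. Let $\rho>-1$ and $W_0$ be real numbers, $W:=W_0-(1+\rho)E[X]$ with $W-M\ge 0$, and $W_\Delta:=W+(1+\rho)\Delta$. Let $\mathcal R$ be the set of $R:[0,M]\to\mathbb R$ with $R(0)=0$ and $0\le R(x)-R(y)\le x-y$ for $0\le y\le x\le M$, and let $\mathbb G:=\{F^{-1}_{R(X)}:R\in\mathcal R\}$. For $0\le\Delta\le E[X]$ consider the problem $$(\ast)\qquad \max_{G\in\mathbb G}\ \int_0^1 u(W_\Delta-G(z))\,T'(z)\,dz\quad\text{subject to}\quad \int_0^1 G(z)\,dz\ge\Delta .$$ **Assumptions.** (1) $F_X$ is strictly increasing on $[0,M]$ and $F_X^{-1}$ is absolutely continuous on $[0,1]$. (2) $T:[0,1]\to[0,1]$ is continuous, strictly increasing and onto, and twice differentiable on $(0,1)$; for some $b\in(0,1)$, $T'$ is strictly decreasing on $(0,b)$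 and strictly increasing on $(b,1)$; $T'(0+)\in(1,+\infty]$ and $T'(1-)=+\infty$. (3) $u:[0,\infty)\to[0,\infty)$ is strictly increasing, twice differentiable on $(0,\infty)$ (and right-differentiable at $0$ in case $W=M$), $u'$ is strictly decreasing, and $A_u$ is strictly decreasing on $(0,\infty)$, where $A_\varphi:=-\varphi''/\varphi'$. (4) $A_T(z)>A_u(W-F_X^{-1}(z))\,(F_X^{-1})'(z)$ for every $z\in(0,a]$ at which $F_X^{-1}$ is differentiable, where $a\in(0,1)$ is the unique point such that $z\mapsto\frac{1-T(z)}{1-z}$ is strictly decreasing on $[0,a]$ and strictly increasing on $[a,1)$. **Notation.** Let $c$ be the unique point of $(a,1)$ with $T(c)=c$. Put $$h_\Delta(z):=\int_0^z\Big[\tfrac{u'(W_\Delta-F_X^{-1}(z))(1-T(z))}{1-z}-u'(W_\Delta-F_X^{-1}(t))T'(t)\Big]dt,\qquad \Delta(d):=\int_0^dF_X^{-1}(z)\,dz+F_X^{-1}(d)(1-d)$$ for $z,d\in[a,c]$, let $l_{\Delta(a)}$, $l_{\Delta(c)}$ be the unique zeros in $[a,c]$ of $h_{\Delta(a)}$,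 $h_{\Delta(c)}$ respectively, and put $\widetilde\Delta:=\Delta(l_{\Delta(a)})$, $\overline\Delta:=\Delta(l_{\Delta(c)})$ and $$g(z):=\int_0^z\Big[\tfrac{u'(W+(1+\rho)\Delta(z)-F_X^{-1}(z))(1-T(z))}{1-z}-u'(W+(1+\rho)\Delta(z)-F_X^{-1}(t))T'(t)\Big]dt .$$ For $0\le z_2\le z_1<1$ the *threefold* function $G_{z_2,z_1}$ equals $0$ on $[0,z_2)$, $F_X^{-1}(z)-F_X^{-1}(z_2)$ on $[z_2,z_1)$ and $F_X^{-1}(z_1)-F_X^{-1}(z_2)$ on $[z_1,1]$. For $f\in[0,1]$ the *deductible* function $D_f$ equals $F_X^{-1}(z)$ on $[0,f)$ and $F_X^{-1}(f)$ on $[f,1]$. Call $(z_2,z_1)$ *$\Delta$-admissible* if $0\le z_2\le a\le z_1<1$, $$\int_{z_2}^{z_1}\Big[\tfrac{u'(W_\Delta-F_X^{-1}(z_1)+F_X^{-1}(z_2))(1-T(z_1))}{1-z_1}-u'(W_\Delta-F_X^{-1}(t)+F_X^{-1}(z_2))T'(t)\Big]dt=0\quad\text{and}\quad\int_0^1G_{z_2,z_1}(z)\,dz=\Delta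 .$$ **Proposition.** Under (1)–(4) the points $a$, $c$, $l_{\Delta(a)}$, $l_{\Delta(c)}$ exist and are unique, and $(\ast)$ has a unique optimal solution $G^*$, given as follows. (i) If $\Delta=0$, then $G^*=0$. (ii) If $0<\Delta\le\widetilde\Delta$, then $\Delta$-admissible pairs exist, and $G^*=G_{z_2,z_1}$ for every such pair. (iii) If $\widetilde\Delta<\Delta<\overline\Delta$, then there is $p\in(l_{\Delta(a)},l_{\Delta(c)})$ with $\Delta(p)=\Delta$, and for every such $p$: if $g(p)<0$, then $\Delta$-admissible pairs exist, and $G^*=G_{z_2,z_1}$ for every such pair; if $g(p)\ge0$, then there is $f\in[0,l_{\Delta(c)})$ with $\int_0^1D_f(z)\,dz=\Delta$, and $G^*=D_f$ for every such $f$. (iv) If $\overline\Delta\le\Delta\le E[X]$, then there is $f\in[l_{\Delta(c)},1]$ with $\int_0^1D_f(z)\,dz=\Delta$, and $G^*=D_f$ for every such $f$. -/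

import Mathlib

open Set Filter Topology MeasureTheory

namespace RDU

noncomputable section

/-- Distribution function `F_Y(x) = P(Y ≤ x)`. -/
def cdfOf {Ω : Type*} [MeasurableSpace Ω] (P : Measure Ω) (Y : Ω → ℝ) (x : ℝ) : ℝ :=
  P.real {ω | Y ω ≤ x}

/-- Quantile function `F_Y⁻¹(t) = inf {x ≥ 0 : P(Y ≤ x) ≥ t}` (used for `t ∈ [0,1]`). -/
def quantile {Ω : Type*} [MeasurableSpace Ω] (P : Measure Ω) (Y : Ω → ℝ) (t : ℝ) : ℝ :=
  sInf {x : ℝ | 0 ≤ x ∧ t ≤ cdfOf P Y x}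

/-- The loss `X` takes values in `[0,M]`, its distribution function is strictly increasing on
`[0,M]`, and its quantile function is absolutely continuous on `[0,1]`. -/
structure IsLoss {Ω : Type*} [MeasurableSpace Ω] (P : Measure Ω) (X : Ω → ℝ) (M : ℝ) : Prop where
  measurable : Measurable X
  mem_Icc : ∀ᵐ ω ∂P, X ω ∈ Icc 0 M
  cdf_strictMono : StrictMonoOn (cdfOf P X) (Icc 0 M)
  quantile_ac : AbsolutelyContinuousOnInterval (quantile P X) 0 1

/-- Utility `u : [0,∞) → [0,∞)`: strictly increasing, twice differentiable on `(0,∞)`,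
with strictly decreasing derivative. -/
structure IsStrictlyConcaveUtility (u : ℝ → ℝ) : Prop where
  nonneg : ∀ x, 0 ≤ x → 0 ≤ u x
  strictMono : StrictMonoOn u (Ici 0)
  differentiable : ∀ x, 0 < x → DifferentiableAt ℝ u x
  deriv_differentiable : ∀ x, 0 < x → DifferentiableAt ℝ (deriv u) x
  deriv_strictAnti : StrictAntiOn (deriv u) (Ioi 0)

/-- Marginal utility `u'` on `[0,∞)`: the usual derivative on `(0,∞)`, the right derivative
at `0`. -/
def marginal (u : ℝ → ℝ) (x : ℝ) : ℝ := derivWithin u (Ici 0) x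

/-- Inverse-S shaped probability weighting function. -/
structure IsInverseS (T : ℝ → ℝ) : Prop where
  continuousOn : ContinuousOn T (Icc 0 1)
  strictMono : StrictMonoOn T (Icc 0 1)
  image_eq : T '' Icc 0 1 = Icc 0 1
  differentiable : ∀ z ∈ Ioo (0 : ℝ) 1, DifferentiableAt ℝ T z
  deriv_differentiable : ∀ z ∈ Ioo (0 : ℝ) 1, DifferentiableAt ℝ (deriv T) z
  shape : ∃ b ∈ Ioo (0 : ℝ) 1,
    StrictAntiOn (deriv T) (Ioo 0 b) ∧ StrictMonoOn (deriv T) (Ioo b 1)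
  /-- `T'(0+)` exists in the extended reals and exceeds `1`. -/
  deriv_zero : ∃ L : EReal, 1 < L ∧ Tendsto (fun z => ((deriv T z : ℝ) : EReal)) (𝓝[>] 0) (𝓝 L)
  deriv_one : Tendsto (deriv T) (𝓝[<] 1) atTop

/-- Arrow–Pratt measure `A_f(x) = - f''(x) / f'(x)`. -/
def arrowPratt (f : ℝ → ℝ) (x : ℝ) : ℝ := -(deriv (deriv f) x) / deriv f x

/-- `f(z) = (1 - T(z)) / (1 - z)` on `[0,1)`. -/
def ratio (T : ℝ → ℝ) (z : ℝ) : ℝ := (1 - T z) / (1 - z)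

/-- `a` is the point of `(0,1)` where `ratio T` turns from strictly decreasing to strictly
increasing. -/
def IsTurningPoint (T : ℝ → ℝ) (a : ℝ) : Prop :=
  a ∈ Ioo (0 : ℝ) 1 ∧ StrictAntiOn (ratio T) (Icc 0 a) ∧ StrictMonoOn (ratio T) (Ico a 1)

/-- `c ∈ (a,1)` is the point where `ratio T c = 1`, that is `T c = c`. -/
def IsUnitPoint (T : ℝ → ℝ) (a c : ℝ) : Prop := c ∈ Ioo a 1 ∧ ratio T c = 1

/-- `x` is the one and only real number with the property `p`. -/
def IsTheOnly (p : ℝ → Prop) (x : ℝ) : Prop := p x ∧ ∀ y, p y → y = x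

/-- `Δ(d) = ∫₀ᵈ Q(z) dz + Q(d) (1 - d)`. -/
def retained (Q : ℝ → ℝ) (d : ℝ) : ℝ := (∫ z in (0 : ℝ)..d, Q z) + Q d * (1 - d)

/-- `∫₀ᶻ [u'(w - Q(z)) (1 - T(z)) / (1 - z) - u'(w - Q(t)) T'(t)] dt`; with `w = W_Δ` this is
`h_Δ(z)`. -/
def hFun (u T Q : ℝ → ℝ) (w z : ℝ) : ℝ :=
  ∫ t in (0 : ℝ)..z,
    (marginal u (w - Q z) * (1 - T z) / (1 - z) - marginal u (w - Q t) * deriv T t)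

/-- `l` is a zero of `h` on `[a,c]`. -/
def IsZeroOfH (u T Q : ℝ → ℝ) (w a c l : ℝ) : Prop := l ∈ Icc a c ∧ hFun u T Q w l = 0

/-- `g(z) = ∫₀ᶻ [u'(W + (1+ρ)Δ(z) - Q(z)) (1 - T(z)) / (1 - z)
  - u'(W + (1+ρ)Δ(z) - Q(t)) T'(t)] dt`. -/
def gFun (u T Q : ℝ → ℝ) (W ρ z : ℝ) : ℝ :=
  ∫ t in (0 : ℝ)..z,
    (marginal u (W + (1 + ρ) * retained Q z - Q z) * (1 - T z) / (1 - z)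
      - marginal u (W + (1 + ρ) * retained Q z - Q t) * deriv T t)

/-- The retention functions: `R(0) = 0`, `0 ≤ R(x) - R(y) ≤ x - y` for `0 ≤ y ≤ x ≤ M`. -/
def retentions (M : ℝ) : Set (ℝ → ℝ) :=
  {R | R 0 = 0 ∧ ∀ x y, 0 ≤ y → y ≤ x → x ≤ M → 0 ≤ R x - R y ∧ R x - R y ≤ x - y}

/-- The set `𝔾` of quantile functions of `R(X)`, `R` a retention function; only the values on
`[0,1]` matter. -/
def quantileSet {Ω : Type*} [MeasurableSpace Ω] (P : Measure Ω) (X : Ω → ℝ) (M : ℝ) :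
    Set (ℝ → ℝ) :=
  {G | ∃ R ∈ retentions M, ∀ z ∈ Icc (0 : ℝ) 1, G z = quantile P (fun ω => R (X ω)) z}

/-- Feasible set of the quantile problem. -/
def feasible {Ω : Type*} [MeasurableSpace Ω] (P : Measure Ω) (X : Ω → ℝ) (M Δ : ℝ) :
    Set (ℝ → ℝ) :=
  {G | G ∈ quantileSet P X M ∧ Δ ≤ ∫ z in (0 : ℝ)..1, G z}

/-- Objective `∫₀¹ u(w - G(z)) T'(z) dz`. -/
def objective (u T : ℝ → ℝ) (w : ℝ) (G : ℝ → ℝ) : ℝ :=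
  ∫ z in (0 : ℝ)..1, u (w - G z) * deriv T z

/-- `G` is the optimal solution of the quantile problem with parameter `Δ` and wealth `w`: it is
feasible, maximizes the objective, and every maximizer agrees with it on `[0,1]`. -/
def IsOptimal {Ω : Type*} [MeasurableSpace Ω] (P : Measure Ω) (X : Ω → ℝ) (M Δ w : ℝ)
    (u T G : ℝ → ℝ) : Prop :=
  G ∈ feasible P X M Δ ∧
  (∀ H ∈ feasible P X M Δ, objective u T w H ≤ objective u T w G) ∧
  (∀ H ∈ feasible P X M Δ, objective u T w H = objective u T w G →
    ∀ z ∈ Icc (0 : ℝ) 1, H z = G z)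

/-- Threefold shape. -/
def threefold (Q : ℝ → ℝ) (z₂ z₁ z : ℝ) : ℝ :=
  if z < z₂ then 0 else if z < z₁ then Q z - Q z₂ else Q z₁ - Q z₂

/-- Deductible shape. -/
def deductible (Q : ℝ → ℝ) (f z : ℝ) : ℝ := if z < f then Q z else Q f

/-- The requirements on the pair `(z₂, z₁)` of a threefold solution. -/
def IsThreefoldPair (u T Q : ℝ → ℝ) (a w Δ z₂ z₁ : ℝ) : Prop :=
  0 ≤ z₂ ∧ z₂ ≤ a ∧ a ≤ z₁ ∧ z₁ < 1 ∧
  (∫ t in z₂..z₁,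
    (marginal u (w - Q z₁ + Q z₂) * (1 - T z₁) / (1 - z₁)
      - marginal u (w - Q t + Q z₂) * deriv T t)) = 0 ∧
  (∫ z in (0 : ℝ)..1, threefold Q z₂ z₁ z) = Δ

/-- The optimal solution is the threefold function of any admissible pair, and admissible pairs
exist. -/
def ThreefoldOptimal {Ω : Type*} [MeasurableSpace Ω] (P : Measure Ω) (X : Ω → ℝ)
    (M Δ w a : ℝ) (u T : ℝ → ℝ) : Prop :=
  (∃ z₂ z₁, IsThreefoldPair u T (quantile P X) a w Δ z₂ z₁) ∧
  ∀ z₂ z₁, IsThreefoldPair u T (quantile P X) a w Δ z₂ z₁ →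
    IsOptimal P X M Δ w u T (threefold (quantile P X) z₂ z₁)

/-- The optimal solution is the deductible function of any `f ∈ S` with integral `Δ`, and such
`f` exist. -/
def DeductibleOptimal {Ω : Type*} [MeasurableSpace Ω] (P : Measure Ω) (X : Ω → ℝ)
    (M Δ w : ℝ) (u T : ℝ → ℝ) (S : Set ℝ) : Prop :=
  (∃ f ∈ S, (∫ z in (0 : ℝ)..1, deductible (quantile P X) f z) = Δ) ∧
  ∀ f ∈ S, (∫ z in (0 : ℝ)..1, deductible (quantile P X) f z) = Δ →
    IsOptimal P X M Δ w u T (deductible (quantile P X) f)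

end

end RDU

/-! Strict concavity of `u` makes the quantile problem a concave programme, so a first-order
condition with one multiplier `l` is sufficient and yields uniqueness. By the tangent inequality,
the objective at `H` exceeds that at `G` by at most `∫ u'(w - G) T' (G - H)`, and the mean
constraint allows subtracting `l` from the weight (`objective_le`). Integrating by parts against the
primitive `N(x) = ∫_1^x (u'(w - G) T' - l)` turns the remaining inequality into the pointwise
requirement `N (G' - H') ≥ 0` (`integral_mul_sub_nonpos`). Since `0 ≤ H' ≤ Q'`, this holds if `G' =
0` where `N ≤ 0` and `G' = Q'` where `N ≥ 0`.

For a threefold `G` with kinks `y ≤ a ≤ z`, the choice `l = v(w + Q y - Q z) * ratio T z` gives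
`N(z) = 0`, and on `[y, z]` the primitive is `kFun` at wealth `w + Q y`. Assumption (4) and
decreasing risk aversion make `v(w - Q) T'` strictly decreasing before `a`, while `ratio T`
increases after `a`. These two facts give all the signs (`sign_condition`) as soon as `kFun`
vanishes at `(y, z)`, or is nonnegative with `y = 0`, the deductible case.

Existence comes from the same function. In `z`, `kFun` is strictly increasing on `[a, 1)`,
nonpositive at `a` and nonnegative at `c`; hence for each `y` it has a zero `ζ y` in `[a, c]`, which
depends continuously on `y`. The mean of the threefold function of `(y, ζ y)` is `0` at `y = a` and
`retained Q (ζ 0)` at `y = 0`, so the intermediate value theorem supplies an admissible pair when `Δ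
≤ retained Q (ζ 0)` (`exists_pair`).

Which shape occurs is thus decided by the sign of `kFun` at `y = 0` and wealth `W_Δ`. Decreasing
absolute risk aversion passes nonnegativity of `kFun` to lower wealth (`kFun_nonneg_of_le`), which
permits comparison with the fixed zeros `la` and `lc`; between them `g(p)` is exactly this sign. -/

namespace RDU

/-! ### Inverse-S weighting: the turning point `a` and the unit point `c`. -/

section Weighting

variable {T : ℝ → ℝ}

theorem strictMonoOn_Ico_of_Ioo {f : ℝ → ℝ} {b c : ℝ} (hf : StrictMonoOn f (Ioo b c))
    (hb : ContinuousAt f b) : StrictMonoOn f (Ico b c) := by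
  intro x hx y hy hxy
  rcases eq_or_lt_of_le hx.1 with h | h
  · subst h
    have hm : (b + y) / 2 ∈ Ioo b c := ⟨by linarith, by linarith [hy.2]⟩
    refine lt_of_le_of_lt ?_ (hf hm ⟨hxy, hy.2⟩ (by linarith))
    have h1 : Tendsto f (𝓝[>] b) (𝓝 (f b)) := hb.tendsto.mono_left nhdsWithin_le_nhds
    refine le_of_tendsto h1 ?_
    filter_upwards [Ioo_mem_nhdsGT hm.1] with s hs
    exact (hf ⟨hs.1, hs.2.trans hm.2⟩ hm hs.2).le
  · exact hf ⟨h, hx.2⟩ ⟨h.trans hxy, hy.2⟩ hxy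

theorem strictAntiOn_Ioc_of_Ioo {f : ℝ → ℝ} {b c : ℝ} (hf : StrictAntiOn f (Ioo c b))
    (hb : ContinuousAt f b) : StrictAntiOn f (Ioc c b) := by
  intro x hx y hy hxy
  rcases eq_or_lt_of_le hy.2 with h | h
  · subst h
    have hm : (x + y) / 2 ∈ Ioo c y := ⟨by linarith [hx.1], by linarith⟩
    refine lt_of_le_of_lt ?_ (hf ⟨hx.1, hxy⟩ hm (by linarith))
    have h1 : Tendsto f (𝓝[<] y) (𝓝 (f y)) := hb.tendsto.mono_left nhdsWithin_le_nhds
    refine le_of_tendsto h1 ?_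
    filter_upwards [Ioo_mem_nhdsLT hm.2] with s hs
    exact (hf hm ⟨hm.1.trans hs.1, hs.2⟩ hs.1).le
  · exact hf ⟨hx.1, hxy.trans h⟩ ⟨hy.1, h⟩ hxy

theorem IsInverseS.map_zero (hT : IsInverseS T) : T 0 = 0 := by
  have h0 : T 0 ∈ Icc (0 : ℝ) 1 := hT.image_eq ▸ mem_image_of_mem T (left_mem_Icc.2 zero_le_one)
  have : (0 : ℝ) ∈ T '' Icc 0 1 := by rw [hT.image_eq]; exact left_mem_Icc.2 zero_le_one
  obtain ⟨x, hx, hx0⟩ := this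
  have := hT.strictMono.monotoneOn (left_mem_Icc.2 zero_le_one) hx hx.1
  linarith [h0.1]

theorem IsInverseS.map_one (hT : IsInverseS T) : T 1 = 1 := by
  have h0 : T 1 ∈ Icc (0 : ℝ) 1 := hT.image_eq ▸ mem_image_of_mem T (right_mem_Icc.2 zero_le_one)
  have : (1 : ℝ) ∈ T '' Icc 0 1 := by rw [hT.image_eq]; exact right_mem_Icc.2 zero_le_one
  obtain ⟨x, hx, hx0⟩ := this
  have := hT.strictMono.monotoneOn hx (right_mem_Icc.2 zero_le_one) hx.2
  linarith [h0.2]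

theorem IsInverseS.continuousAt_deriv (hT : IsInverseS T) {z : ℝ} (hz : z ∈ Ioo (0 : ℝ) 1) :
    ContinuousAt (deriv T) z :=
  (hT.deriv_differentiable z hz).continuousAt

theorem IsInverseS.deriv_nonneg (hT : IsInverseS T) {z : ℝ} (hz : z ∈ Ioo (0 : ℝ) 1) :
    0 ≤ deriv T z := by
  have h := hT.strictMono.monotoneOn.derivWithin_nonneg (x := z)
  rwa [derivWithin_of_mem_nhds (Icc_mem_nhds hz.1 hz.2)] at h

/-- The derivative of an inverse-S shaped function vanishes at one point at most. -/
theorem IsInverseS.exists_deriv_pos (hT : IsInverseS T) :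
    ∃ b, ∀ z ∈ Ioo (0 : ℝ) 1, z ≠ b → 0 < deriv T z := by
  obtain ⟨b, hb, hanti, hmono⟩ := hT.shape
  refine ⟨b, fun z hz hzb => ?_⟩
  rcases lt_or_gt_of_ne hzb with h | h
  · have hm : (z + b) / 2 ∈ Ioo (0 : ℝ) b := ⟨by linarith [hz.1, hb.1], by linarith⟩
    have := hanti ⟨hz.1, h⟩ hm (by linarith)
    linarith [hT.deriv_nonneg (z := (z + b) / 2) ⟨hm.1, hm.2.trans hb.2⟩]
  · have hm : (z + b) / 2 ∈ Ioo b (1 : ℝ) := ⟨by linarith, by linarith [hz.2, hb.2]⟩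
    have := hmono hm ⟨h, hz.2⟩ (by linarith)
    linarith [hT.deriv_nonneg (z := (z + b) / 2) ⟨hb.1.trans hm.1, hm.2⟩]

theorem IsInverseS.intervalIntegrable_deriv (hT : IsInverseS T) {s t : ℝ}
    (hs : s ∈ Icc (0 : ℝ) 1) (ht : t ∈ Icc (0 : ℝ) 1) :
    IntervalIntegrable (deriv T) volume s t := by
  have h : IntervalIntegrable (deriv T) volume 0 1 := by
    refine MonotoneOn.intervalIntegrable_deriv ?_
    rw [uIcc_of_le zero_le_one]
    exact hT.strictMono.monotoneOn
  refine h.mono_set ?_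
  rw [uIcc_of_le zero_le_one]
  exact ordConnected_Icc.uIcc_subset hs ht

theorem IsInverseS.integral_deriv (hT : IsInverseS T) {s t : ℝ}
    (hs : s ∈ Icc (0 : ℝ) 1) (ht : t ∈ Icc (0 : ℝ) 1) (hst : s ≤ t) :
    ∫ x in s..t, deriv T x = T t - T s := by
  refine intervalIntegral.integral_eq_sub_of_hasDerivAt_of_le hst
    (hT.continuousOn.mono (Icc_subset_Icc hs.1 ht.2)) (fun x hx => ?_)
    (hT.intervalIntegrable_deriv hs ht)
  exact (hT.differentiable x ⟨hs.1.trans_lt hx.1, hx.2.trans_le ht.2⟩).hasDerivAt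

theorem IsInverseS.exists_deriv_eq_slope (hT : IsInverseS T) {s t : ℝ}
    (hs : 0 ≤ s) (ht : t ≤ 1) (hst : s < t) :
    ∃ ξ ∈ Ioo s t, T t - T s = deriv T ξ * (t - s) := by
  obtain ⟨ξ, hξ, h⟩ := _root_.exists_deriv_eq_slope T hst
    (hT.continuousOn.mono (Icc_subset_Icc hs ht))
    (fun x hx => (hT.differentiable x
      ⟨hs.trans_lt hx.1, hx.2.trans_le ht⟩).differentiableWithinAt)
  refine ⟨ξ, hξ, ?_⟩
  rw [h, div_mul_cancel₀ _ (sub_pos.2 hst).ne']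

theorem ratio_zero (hT : IsInverseS T) : ratio T 0 = 1 := by simp [ratio, hT.map_zero]

theorem ratio_mul {z : ℝ} (hz : z < 1) : ratio T z * (1 - z) = 1 - T z :=
  div_mul_cancel₀ _ (sub_pos.2 hz).ne'

theorem ratio_pos (hT : IsInverseS T) {z : ℝ} (h0 : 0 ≤ z) (hz : z < 1) : 0 < ratio T z := by
  have := hT.strictMono ⟨h0, hz.le⟩ (right_mem_Icc.2 zero_le_one) hz
  rw [hT.map_one] at this
  exact div_pos (by linarith) (by linarith)

theorem continuousOn_ratio (hT : IsInverseS T) : ContinuousOn (ratio T) (Ico 0 1) := by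
  refine ContinuousOn.div (continuousOn_const.sub (hT.continuousOn.mono Ico_subset_Icc_self))
    (by fun_prop) fun z hz => (sub_pos.2 hz.2).ne'

theorem hasDerivAt_ratio (hT : IsInverseS T) {z : ℝ} (hz : z ∈ Ioo (0 : ℝ) 1) :
    HasDerivAt (ratio T) ((ratio T z - deriv T z) / (1 - z)) z := by
  have h1 : (1 - z) ≠ 0 := (sub_pos.2 hz.2).ne'
  have := ((hT.differentiable z hz).hasDerivAt.const_sub 1).div
    ((hasDerivAt_id z).const_sub 1) h1
  refine this.congr_deriv ?_
  simp only [ratio, id]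
  field_simp
  ring

/-- `T'` lies above `ratio T` before the turning point and below it afterwards; `T'` is
strictly decreasing up to the turning point. -/
theorem IsInverseS.exists_crossing (hT : IsInverseS T) :
    ∃ a ∈ Ioo (0 : ℝ) 1, StrictAntiOn (deriv T) (Ioc 0 a) ∧ deriv T a = ratio T a ∧
      (∀ z ∈ Ioo 0 a, ratio T z < deriv T z) ∧ (∀ z ∈ Ioo a 1, deriv T z < ratio T z) := by
  obtain ⟨b, hb, hanti, hmono⟩ := hT.shape
  have hanti := strictAntiOn_Ioc_of_Ioo hanti (hT.continuousAt_deriv hb)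
  have hmono := strictMonoOn_Ico_of_Ioo hmono (hT.continuousAt_deriv hb)
  -- `φ` has the sign of the derivative of `ratio T`. It is positive on `[b, 1)`, strictly
  -- increasing on `(0, b]` and negative near `0`, so it changes sign exactly once.
  set φ : ℝ → ℝ := fun z => (1 - T z) - deriv T z * (1 - z) with hφ
  have hφr : ∀ z, z < 1 → φ z = (ratio T z - deriv T z) * (1 - z) := fun z hz => by
    simp only [hφ]; rw [sub_mul, ratio_mul hz]
  have hφb : ∀ z ∈ Ico b 1, 0 < φ z := fun z hz => by
    obtain ⟨ξ, hξ, h⟩ := hT.exists_deriv_eq_slope (hb.1.le.trans hz.1) le_rfl hz.2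
    rw [hT.map_one] at h
    have := hmono hz ⟨hz.1.trans hξ.1.le, hξ.2⟩ hξ.1
    simp only [hφ]; rw [h, ← sub_mul]
    exact mul_pos (by linarith) (by linarith [hz.2])
  have hφm : StrictMonoOn φ (Ioc 0 b) := fun x hx y hy hxy => by
    obtain ⟨ξ, hξ, h⟩ := hT.exists_deriv_eq_slope hx.1.le (hy.2.trans hb.2.le) hxy
    have h1 := hanti hx ⟨hx.1.trans hξ.1, hξ.2.le.trans hy.2⟩ hξ.1
    have h2 := hanti hx hy hxy
    have h3 : deriv T ξ * (y - x) < deriv T x * (y - x) :=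
      mul_lt_mul_of_pos_right h1 (by linarith)
    have h4 : deriv T y * (1 - y) < deriv T x * (1 - y) :=
      mul_lt_mul_of_pos_right h2 (by linarith [hy.2, hb.2])
    simp only [hφ]
    nlinarith
  obtain ⟨z₀, hz₀, hφz₀⟩ : ∃ z ∈ Ioo 0 b, φ z < 0 := by
    obtain ⟨L, hL, hlim⟩ := hT.deriv_zero
    obtain ⟨q, hq1, hqL⟩ := EReal.lt_iff_exists_real_btwn.1 hL
    have hq1 : 1 < q := by exact_mod_cast hq1
    -- For `z < 1 - 1/q` and `T' z > q`, one has `T' z * (1 - z) > q * (1 - z) > 1 ≥ 1 - T z`, that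
    -- is `φ z < 0`.
    have hpos : 0 < min b (1 - q⁻¹) := lt_min hb.1 (sub_pos.2 (inv_lt_one_of_one_lt₀ hq1))
    obtain ⟨z, hzq, hz⟩ := ((hlim.eventually (lt_mem_nhds hqL)).and (Ioo_mem_nhdsGT hpos)).exists
    have hzq : q < deriv T z := by exact_mod_cast hzq
    refine ⟨z, ⟨hz.1, hz.2.trans_le (min_le_left _ _)⟩, ?_⟩
    have hzb := hz.2.trans_le (min_le_left _ _)
    have hT0 : 0 ≤ T z := by
      rw [← hT.map_zero]
      exact hT.strictMono.monotoneOn (left_mem_Icc.2 zero_le_one)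
        ⟨hz.1.le, (hzb.trans hb.2).le⟩ hz.1.le
    have h1 : q * (1 - z) < deriv T z * (1 - z) :=
      mul_lt_mul_of_pos_right hzq (by linarith [hb.2])
    have h2 : q * q⁻¹ = 1 := mul_inv_cancel₀ (by linarith)
    have h3 : q * z < q * (1 - q⁻¹) :=
      mul_lt_mul_of_pos_left (hz.2.trans_le (min_le_right _ _)) (by linarith)
    simp only [hφ]
    nlinarith
  have hcont : ContinuousOn φ (Icc z₀ b) := fun x hx => by
    have hx' : x ∈ Ioo (0 : ℝ) 1 := ⟨hz₀.1.trans_le hx.1, hx.2.trans_lt hb.2⟩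
    have h1 := (hT.differentiable x hx').continuousAt
    have h2 := hT.continuousAt_deriv hx'
    exact ContinuousAt.continuousWithinAt (by fun_prop)
  obtain ⟨a, ha, hφa⟩ := intermediate_value_Ioo hz₀.2.le hcont ⟨hφz₀, hφb b ⟨le_rfl, hb.2⟩⟩
  have ha0 : 0 < a := hz₀.1.trans ha.1
  have ha1 : a < 1 := ha.2.trans hb.2
  refine ⟨a, ⟨ha0, ha1⟩, hanti.mono (Ioc_subset_Ioc_right ha.2.le), ?_, fun z hz => ?_,
    fun z hz => ?_⟩
  · rw [hφr a ha1] at hφa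
    rcases mul_eq_zero.1 hφa with h | h <;> linarith
  · have := hφm ⟨hz.1, (hz.2.trans ha.2).le⟩ ⟨ha0, ha.2.le⟩ hz.2
    rw [hφa, hφr z (hz.2.trans ha1)] at this
    nlinarith [hz.2]
  · have : 0 < φ z := by
      rcases le_total z b with h | h
      · rw [← hφa]; exact hφm ⟨ha0, ha.2.le⟩ ⟨ha0.trans hz.1, h⟩ hz.1
      · exact hφb z ⟨h, hz.2⟩
    rw [hφr z hz.2] at this
    nlinarith [hz.2]

theorem IsInverseS.exists_turningPoint (hT : IsInverseS T) :
    ∃ a, IsTurningPoint T a ∧ StrictAntiOn (deriv T) (Ioc 0 a) ∧ deriv T a = ratio T a := by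
  obtain ⟨a, ha, hanti, haeq, hlow, hup⟩ := hT.exists_crossing
  refine ⟨a, ⟨ha, ?_, ?_⟩, hanti, haeq⟩
  · refine strictAntiOn_of_deriv_neg (convex_Icc 0 a)
      ((continuousOn_ratio hT).mono fun x hx => ⟨hx.1, hx.2.trans_lt ha.2⟩) fun x hx => ?_
    rw [interior_Icc] at hx
    rw [(hasDerivAt_ratio hT ⟨hx.1, hx.2.trans ha.2⟩).deriv]
    exact div_neg_of_neg_of_pos (sub_neg.2 (hlow x hx)) (by linarith [hx.2, ha.2])
  · refine strictMonoOn_of_deriv_pos (convex_Ico a 1)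
      ((continuousOn_ratio hT).mono fun x hx => ⟨ha.1.le.trans hx.1, hx.2⟩) fun x hx => ?_
    rw [interior_Ico] at hx
    rw [(hasDerivAt_ratio hT ⟨ha.1.trans hx.1, hx.2⟩).deriv]
    exact div_pos (sub_pos.2 (hup x hx)) (by linarith [hx.2])

theorem IsTurningPoint.unique {a a' : ℝ} (h : IsTurningPoint T a) (h' : IsTurningPoint T a') :
    a' = a := by
  have key : ∀ {x y : ℝ}, IsTurningPoint T x → IsTurningPoint T y → ¬ x < y := by
    intro x y hx hy hxy
    have h1 := hx.2.2 ⟨le_rfl, hx.1.2⟩ ⟨hxy.le, hy.1.2⟩ hxy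
    have h2 := hy.2.1 ⟨hx.1.1.le, hxy.le⟩ ⟨hy.1.1.le, le_rfl⟩ hxy
    exact lt_asymm h1 h2
  exact le_antisymm (not_lt.1 (key h h')) (not_lt.1 (key h' h))

/-- `ratio T` starts at `1` and decreases up to `a`, so it is below `1` there. Near `1` it is a mean
value of `T'` at points where `T' > 1`, so it exceeds `1`. -/
theorem IsTurningPoint.exists_unitPoint (hT : IsInverseS T) {a : ℝ} (ha : IsTurningPoint T a) :
    ∃ c, IsTheOnly (IsUnitPoint T a) c := by
  obtain ⟨b, hb, -, hmono⟩ := hT.shape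
  have hra : ratio T a < 1 := by
    rw [← ratio_zero hT]
    exact ha.2.1 ⟨le_rfl, ha.1.1.le⟩ ⟨ha.1.1.le, le_rfl⟩ ha.1.1
  obtain ⟨x, hx1, hx⟩ := ((hT.deriv_one.eventually_gt_atTop 1).and
    (Ioo_mem_nhdsLT (max_lt ha.1.2 hb.2))).exists
  have hxa : a < x := (le_max_left _ _).trans_lt hx.1
  have hxb : b < x := (le_max_right _ _).trans_lt hx.1
  have hrx : 1 < ratio T x := by
    obtain ⟨ξ, hξ, h⟩ := hT.exists_deriv_eq_slope (ha.1.1.trans hxa).le le_rfl hx.2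
    rw [hT.map_one] at h
    have h2 := hmono ⟨hxb, hx.2⟩ ⟨hxb.trans hξ.1, hξ.2⟩ hξ.1
    rw [ratio, h, mul_div_cancel_right₀ _ (sub_pos.2 hx.2).ne']
    linarith
  obtain ⟨c, hc, hrc⟩ := intermediate_value_Ioo hxa.le
    ((continuousOn_ratio hT).mono fun y hy => ⟨ha.1.1.le.trans hy.1, hy.2.trans_lt hx.2⟩)
    ⟨hra, hrx⟩
  refine ⟨c, ⟨⟨hc.1, hc.2.trans hx.2⟩, hrc⟩, fun y hy => ?_⟩
  exact ha.2.2.injOn ⟨hy.1.1.le, hy.1.2⟩ ⟨hc.1.le, hc.2.trans hx.2⟩ (hy.2.trans hrc.symm)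

end Weighting

/-! ### Marginal utility up to the boundary, and decreasing absolute risk aversion. -/

section Utility

variable {u : ℝ → ℝ}

theorem marginal_of_pos (u : ℝ → ℝ) {x : ℝ} (hx : 0 < x) : marginal u x = deriv u x :=
  derivWithin_of_mem_nhds (Ici_mem_nhds hx)

theorem IsStrictlyConcaveUtility.deriv_pos (hu : IsStrictlyConcaveUtility u) {x : ℝ}
    (hx : 0 < x) : 0 < deriv u x := by
  have h : 0 ≤ deriv u (x + 1) := by
    have h := hu.strictMono.monotoneOn.derivWithin_nonneg (x := x + 1)
    rwa [derivWithin_of_mem_nhds (Ici_mem_nhds (by linarith))] at h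
  exact h.trans_lt (hu.deriv_strictAnti (mem_Ioi.2 hx) (mem_Ioi.2 (by linarith)) (by linarith))

theorem IsStrictlyConcaveUtility.exists_deriv_eq_slope (hu : IsStrictlyConcaveUtility u)
    {s t : ℝ} (hs : 0 ≤ s) (hst : s < t) (hcont : ContinuousWithinAt u (Ici 0) s) :
    ∃ ξ ∈ Ioo s t, u t - u s = deriv u ξ * (t - s) := by
  obtain ⟨ξ, hξ, h⟩ := _root_.exists_deriv_eq_slope u hst
    (fun x hx => by
      rcases eq_or_lt_of_le hx.1 with h | h
      · subst h; exact hcont.mono fun y hy => hs.trans hy.1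
      · exact (hu.differentiable x (hs.trans_lt h)).continuousAt.continuousWithinAt)
    (fun x hx => (hu.differentiable x (hs.trans_lt hx.1)).differentiableWithinAt)
  refine ⟨ξ, hξ, ?_⟩
  rw [h, div_mul_cancel₀ _ (sub_pos.2 hst).ne']

/-- Strict tangent inequality. -/
theorem IsStrictlyConcaveUtility.sub_lt (hu : IsStrictlyConcaveUtility u) {x y : ℝ}
    (hx : 0 < x) (hy : 0 < y) (hxy : y ≠ x) : u y - u x < deriv u x * (y - x) := by
  rcases lt_or_gt_of_ne hxy with h | h
  · obtain ⟨ξ, hξ, he⟩ := hu.exists_deriv_eq_slope hy.le h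
      (hu.differentiable y hy).continuousAt.continuousWithinAt
    have := hu.deriv_strictAnti (mem_Ioi.2 (hy.trans hξ.1)) (mem_Ioi.2 hx) hξ.2
    nlinarith
  · obtain ⟨ξ, hξ, he⟩ := hu.exists_deriv_eq_slope hx.le h
      (hu.differentiable x hx).continuousAt.continuousWithinAt
    have := hu.deriv_strictAnti (mem_Ioi.2 hx) (mem_Ioi.2 (hx.trans hξ.1)) hξ.1
    nlinarith

/-- Concavity squeezes `u' x` between the slope over `[x, 2x]` and the slope over `[0, x]`; both
tend to the right derivative, the former being twice the slope over `[0, 2x]` minus the slope over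
`[0, x]`. -/
theorem tendsto_deriv_nhdsGT_zero (hu : IsStrictlyConcaveUtility u)
    (h0 : DifferentiableWithinAt ℝ u (Ici 0) 0) :
    Tendsto (deriv u) (𝓝[>] 0) (𝓝 (marginal u 0)) := by
  have hslope : Tendsto (fun x => (u x - u 0) / x) (𝓝[>] 0) (𝓝 (marginal u 0)) := by
    have h := h0.hasDerivWithinAt
    rw [hasDerivWithinAt_iff_tendsto_slope] at h
    have hs : (Ici (0 : ℝ) \ {0}) = Ioi 0 := by
      ext x; simp [lt_iff_le_and_ne, eq_comm]
    rw [hs] at h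
    refine h.congr fun x => ?_
    simp [slope_def_field]
  have hslope2 : Tendsto (fun x => (u (2 * x) - u 0) / (2 * x)) (𝓝[>] 0) (𝓝 (marginal u 0)) := by
    refine hslope.comp (tendsto_nhdsWithin_iff.2 ⟨?_, ?_⟩)
    · have : Tendsto (fun x : ℝ => 2 * x) (𝓝 0) (𝓝 (2 * 0)) := by
        exact (continuous_const.mul continuous_id).tendsto 0
      rw [mul_zero] at this
      exact this.mono_left nhdsWithin_le_nhds
    · filter_upwards [self_mem_nhdsWithin] with x hx
      have : (0 : ℝ) < x := hx
      simpa using this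
  have hlow := (hslope2.const_mul 2).sub hslope
  rw [show 2 * marginal u 0 - marginal u 0 = marginal u 0 by ring] at hlow
  refine tendsto_of_tendsto_of_tendsto_of_le_of_le' hlow hslope ?_ ?_
  · filter_upwards [self_mem_nhdsWithin] with x hx
    have hx : 0 < x := hx
    obtain ⟨ξ, hξ, he⟩ := hu.exists_deriv_eq_slope hx.le (show x < 2 * x by linarith)
      (hu.differentiable x hx).continuousAt.continuousWithinAt
    have := hu.deriv_strictAnti (mem_Ioi.2 hx) (mem_Ioi.2 (hx.trans hξ.1)) hξ.1
    have h2 : 2 * ((u (2 * x) - u 0) / (2 * x)) - (u x - u 0) / x = deriv u ξ := by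
      field_simp
      linarith
    rw [h2]
    exact this.le
  · filter_upwards [self_mem_nhdsWithin] with x hx
    have hx : 0 < x := hx
    obtain ⟨ξ, hξ, he⟩ := hu.exists_deriv_eq_slope le_rfl hx h0.continuousWithinAt
    have := hu.deriv_strictAnti (mem_Ioi.2 hξ.1) (mem_Ioi.2 hx) hξ.2
    rw [he, sub_zero, mul_div_cancel_right₀ _ hx.ne']
    exact this.le

/-- Marginal utility, extended by a constant below the level `m`. -/
noncomputable def marginalFrom (u : ℝ → ℝ) (m x : ℝ) : ℝ := marginal u (max x m)

theorem marginalFrom_of_le (u : ℝ → ℝ) {m x : ℝ} (h : m ≤ x) :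
    marginalFrom u m x = marginal u x := by rw [marginalFrom, max_eq_left h]

theorem continuousOn_marginal (hu : IsStrictlyConcaveUtility u) {m : ℝ} (hm : 0 ≤ m)
    (hu0 : m = 0 → DifferentiableWithinAt ℝ u (Ici 0) 0) :
    ContinuousOn (marginal u) (Ici m) := by
  intro x hx
  rcases eq_or_lt_of_le (hm.trans hx) with h | h
  · subst h
    have hm0 : m = 0 := le_antisymm hx hm
    subst hm0
    have := tendsto_deriv_nhdsGT_zero hu (hu0 rfl)
    rw [← continuousWithinAt_Ioi_iff_Ici]
    refine this.congr' ?_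
    filter_upwards [self_mem_nhdsWithin] with y hy
    exact (marginal_of_pos u hy).symm
  · refine ContinuousAt.continuousWithinAt ?_
    refine (hu.deriv_differentiable x h).continuousAt.congr ?_
    filter_upwards [Ioi_mem_nhds h] with y hy
    exact (marginal_of_pos u hy).symm

theorem continuous_marginalFrom (hu : IsStrictlyConcaveUtility u) {m : ℝ} (hm : 0 ≤ m)
    (hu0 : m = 0 → DifferentiableWithinAt ℝ u (Ici 0) 0) :
    Continuous (marginalFrom u m) :=
  (continuousOn_marginal hu hm hu0).comp_continuous (by fun_prop) fun _ =>
    mem_Ici.2 (le_max_right _ _)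

theorem antitoneOn_marginal (hu : IsStrictlyConcaveUtility u) {m : ℝ} (hm : 0 ≤ m)
    (hu0 : m = 0 → DifferentiableWithinAt ℝ u (Ici 0) 0) :
    AntitoneOn (marginal u) (Ici m) := by
  intro x hx y hy hxy
  rcases eq_or_lt_of_le hxy with h | h
  · rw [h]
  rcases eq_or_lt_of_le (hm.trans hx) with h' | h'
  · subst h'
    have hm0 : m = 0 := le_antisymm hx hm
    subst hm0
    refine ge_of_tendsto (tendsto_deriv_nhdsGT_zero hu (hu0 rfl)) ?_
    filter_upwards [Ioo_mem_nhdsGT h] with s hs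
    rw [marginal_of_pos u h]
    exact (hu.deriv_strictAnti (mem_Ioi.2 hs.1) (mem_Ioi.2 h) hs.2).le
  · rw [marginal_of_pos u h', marginal_of_pos u (h'.trans h)]
    exact (hu.deriv_strictAnti (mem_Ioi.2 h') (mem_Ioi.2 (h'.trans h)) h).le

theorem antitone_marginalFrom (hu : IsStrictlyConcaveUtility u) {m : ℝ} (hm : 0 ≤ m)
    (hu0 : m = 0 → DifferentiableWithinAt ℝ u (Ici 0) 0) :
    Antitone (marginalFrom u m) := fun _ _ hxy =>
  antitoneOn_marginal hu hm hu0 (mem_Ici.2 (le_max_right _ _)) (mem_Ici.2 (le_max_right _ _))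
    (max_le_max_right m hxy)

theorem marginalFrom_pos (hu : IsStrictlyConcaveUtility u) {m : ℝ} (hm : 0 ≤ m)
    (hu0 : m = 0 → DifferentiableWithinAt ℝ u (Ici 0) 0) (x : ℝ) : 0 < marginalFrom u m x := by
  have h := antitone_marginalFrom hu hm hu0 (show x ≤ max x m + 1 by
    linarith [le_max_left x m])
  refine lt_of_lt_of_le ?_ h
  have h1 : m ≤ max x m + 1 := by linarith [le_max_right x m]
  have h2 : 0 < max x m + 1 := by linarith [le_max_right x m]
  rw [marginalFrom_of_le u h1, marginal_of_pos u h2]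
  exact hu.deriv_pos h2

theorem hasDerivAt_log_deriv (hu : IsStrictlyConcaveUtility u) {x : ℝ} (hx : 0 < x) :
    HasDerivAt (fun y => Real.log (deriv u y)) (-arrowPratt u x) x := by
  refine ((hu.deriv_differentiable x hx).hasDerivAt.log (hu.deriv_pos hx).ne').congr_deriv ?_
  rw [arrowPratt]; ring

/-- Under decreasing absolute risk aversion, the ratio of marginal utilities at distance `d`
increases with wealth. -/
theorem deriv_mul_deriv_le (hu : IsStrictlyConcaveUtility u)
    (hAu : StrictAntiOn (arrowPratt u) (Ioi 0)) {x y d : ℝ} (hx : 0 < x) (hxy : x ≤ y)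
    (hd : 0 ≤ d) : deriv u (x + d) * deriv u y ≤ deriv u (y + d) * deriv u x := by
  -- The derivative of this log ratio is `A_u(s) - A_u(s + d) ≥ 0`.
  set D : ℝ → ℝ := fun s => Real.log (deriv u (s + d)) - Real.log (deriv u s)
  have hD : ∀ s, 0 < s → HasDerivAt D (-arrowPratt u (s + d) - -arrowPratt u s) s := fun s hs =>
    (HasDerivAt.comp_add_const s d (hasDerivAt_log_deriv hu (by linarith))).sub
      (hasDerivAt_log_deriv hu hs)
  have hmono : MonotoneOn D (Ioi 0) := by
    refine monotoneOn_of_deriv_nonneg (convex_Ioi 0)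
      (fun s hs => (hD s hs).continuousAt.continuousWithinAt)
      (fun s hs => ?_) fun s hs => ?_
    · rw [interior_Ioi] at hs
      exact (hD s hs).differentiableAt.differentiableWithinAt
    · rw [interior_Ioi] at hs
      rw [(hD s hs).deriv]
      have hs' : 0 < s := hs
      have := hAu.antitoneOn hs (mem_Ioi.2 (by linarith : 0 < s + d)) (by linarith)
      linarith
  have h := hmono (mem_Ioi.2 hx) (mem_Ioi.2 (hx.trans_le hxy)) hxy
  have p1 := hu.deriv_pos hx
  have p2 := hu.deriv_pos (hx.trans_le hxy)
  have p3 := hu.deriv_pos (by linarith : 0 < x + d)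
  have p4 := hu.deriv_pos (by linarith : 0 < y + d)
  rw [← Real.log_le_log_iff (mul_pos p3 p2) (mul_pos p4 p1), Real.log_mul p3.ne' p2.ne',
    Real.log_mul p4.ne' p1.ne']
  simp only [D] at h
  linarith

theorem marginalFrom_mul_le (hu : IsStrictlyConcaveUtility u)
    (hAu : StrictAntiOn (arrowPratt u) (Ioi 0)) {m : ℝ} (hm : 0 ≤ m)
    (hu0 : m = 0 → DifferentiableWithinAt ℝ u (Ici 0) 0) {x y d : ℝ} (hx : m ≤ x) (hxy : x ≤ y)
    (hd : 0 ≤ d) :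
    marginalFrom u m (x + d) * marginalFrom u m y
      ≤ marginalFrom u m (y + d) * marginalFrom u m x := by
  have hc := continuous_marginalFrom hu hm hu0
  have hlim : ∀ z, Tendsto (fun e => marginalFrom u m (z + e)) (𝓝[>] 0)
      (𝓝 (marginalFrom u m z)) := fun z => by
    have : Tendsto (fun e => marginalFrom u m (z + e)) (𝓝 0) (𝓝 (marginalFrom u m (z + 0))) :=
      (hc.comp (continuous_const.add continuous_id)).tendsto 0
    rw [add_zero] at this
    exact this.mono_left nhdsWithin_le_nhds
  -- The level `x` may be `0`, where only a one-sided derivative exists. The inequality is proved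
  -- with both wealth levels shifted by `e > 0`, then `e → 0`.
  refine le_of_tendsto_of_tendsto ((hlim (x + d)).mul (hlim y)) ((hlim (y + d)).mul (hlim x)) ?_
  filter_upwards [self_mem_nhdsWithin] with e he
  have he : 0 < e := he
  have key : ∀ z, m ≤ z → marginalFrom u m (z + e) = deriv u (z + e) := fun z hz => by
    rw [marginalFrom_of_le u (by linarith), marginal_of_pos u (by linarith)]
  rw [key _ (by linarith), key _ (by linarith), key _ (by linarith), key _ hx]
  have := deriv_mul_deriv_le hu hAu (x := x + e) (y := y + e) (by linarith) (by linarith) hd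
  rwa [add_right_comm x e d, add_right_comm y e d] at this

end Utility

/-! ### The weighted marginal utility decreases before the turning point. -/

section Decrease

/-- A function whose increments are dominated by those of an absolutely continuous function is
absolutely continuous. -/
theorem absolutelyContinuousOnInterval_of_dist_le {f g : ℝ → ℝ} {a b C : ℝ}
    (hg : AbsolutelyContinuousOnInterval g a b)
    (h : ∀ x ∈ uIcc a b, ∀ y ∈ uIcc a b, dist (f x) (f y) ≤ C * dist (g x) (g y)) :
    AbsolutelyContinuousOnInterval f a b := by
  unfold AbsolutelyContinuousOnInterval at hg ⊢
  refine squeeze_zero' (Eventually.of_forall fun E => Finset.sum_nonneg fun i _ => dist_nonneg)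
    ?_ (by simpa using hg.const_mul C)
  refine eventually_inf_principal.2 (Eventually.of_forall fun E hE => ?_)
  rw [Finset.mul_sum]
  exact Finset.sum_le_sum fun i hi => h _ (hE.1 i hi).1 _ (hE.1 i hi).2

theorem intervalIntegral_pos_of_ae_pos {f : ℝ → ℝ} {a b : ℝ} (hab : a < b)
    (hf : IntervalIntegrable f volume a b) (hpos : ∀ᵐ x, x ∈ Ioo a b → 0 < f x) :
    0 < ∫ x in a..b, f x := by
  have hpos' : ∀ᵐ x ∂volume.restrict (Ioc a b), 0 < f x := by
    refine ae_restrict_of_ae_eq_of_ae_restrict Ioo_ae_eq_Ioc ?_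
    rwa [ae_restrict_iff' measurableSet_Ioo]
  rw [intervalIntegral.integral_of_le hab.le]
  rw [integral_pos_iff_support_of_nonneg_ae (hpos'.mono fun x hx => hx.le) hf.1]
  refine pos_iff_ne_zero.2 fun h0 => ?_
  have h1 : ∀ᵐ x ∂volume.restrict (Ioc a b), f x = 0 := by
    rw [ae_iff]; exact h0
  have h2 : ∀ᵐ x ∂volume.restrict (Ioc a b), False := by
    filter_upwards [hpos', h1] with x h1 h2
    exact h1.ne' h2
  rw [ae_iff] at h2
  simp [hab.not_ge] at h2

variable {u T Q : ℝ → ℝ} {W M : ℝ}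

/-- Under `A_T > A_u(W - Q) Q'` on `(0,a]` and decreasing absolute risk aversion, the weighted
marginal utility of a fully retained loss is strictly decreasing on `(0,a]`, for each initial
wealth of at least `W`. -/
theorem strictAntiOn_deriv_mul_deriv (hu : IsStrictlyConcaveUtility u)
    (hAu : StrictAntiOn (arrowPratt u) (Ioi 0)) (hT : IsInverseS T) {a : ℝ}
    (ha : a ∈ Ioo (0 : ℝ) 1) (hTa : StrictAntiOn (deriv T) (Ioc 0 a))
    (hda : 0 < deriv T a)
    (hQ : AbsolutelyContinuousOnInterval Q 0 1) (hQm : MonotoneOn Q (Icc 0 1))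
    (hQM : ∀ t ∈ Icc (0 : ℝ) 1, Q t ≤ M) (hWM : 0 ≤ W - M)
    (hAT : ∀ z ∈ Ioc 0 a, DifferentiableAt ℝ Q z →
      arrowPratt u (W - Q z) * deriv Q z < arrowPratt T z)
    {w : ℝ} (hw : W ≤ w) (hwa : 0 < w - Q a) :
    StrictAntiOn (fun t => deriv u (w - Q t) * deriv T t) (Ioc 0 a) := by
  have hIcc : ∀ {z}, z ∈ Ioc 0 a → z ∈ Icc (0 : ℝ) 1 := fun hz => ⟨hz.1.le, hz.2.trans ha.2.le⟩
  have hIoo : ∀ {z}, z ∈ Ioc 0 a → z ∈ Ioo (0 : ℝ) 1 := fun hz => ⟨hz.1, hz.2.trans_lt ha.2⟩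
  have haI : a ∈ Ioc 0 a := ⟨ha.1, le_rfl⟩
  have hTpos : ∀ z ∈ Ioc 0 a, 0 < deriv T z := fun z hz =>
    hda.trans_le (hTa.antitoneOn hz haI hz.2)
  have hwpos : ∀ z ∈ Ioc 0 a, 0 < w - Q z := fun z hz => by
    linarith [hQm (hIcc hz) (hIcc haI) hz.2]
  intro s hs t ht hst
  have hsub : ∀ {z}, z ∈ Icc s t → z ∈ Ioc 0 a := fun hz => ⟨hs.1.trans_le hz.1, hz.2.trans ht.2⟩
  set φ₁ : ℝ → ℝ := fun x => Real.log (deriv u (w - Q x)) with hφ₁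
  set φ₂ : ℝ → ℝ := fun x => -Real.log (deriv T x) with hφ₂
  have hQst : AbsolutelyContinuousOnInterval Q s t := by
    refine hQ.mono ?_
    rw [uIcc_of_le hst.le, uIcc_of_le zero_le_one]
    exact fun z hz => hIcc (hsub hz)
  have hAuNonneg : ∀ x, 0 < x → 0 ≤ arrowPratt u x := fun x hx => by
    have h : deriv (deriv u) x ≤ 0 := by
      have h := hu.deriv_strictAnti.antitoneOn.derivWithin_nonpos (x := x)
      rwa [derivWithin_of_mem_nhds (Ioi_mem_nhds hx)] at h
    exact div_nonneg (by linarith) (hu.deriv_pos hx).le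
  -- On `[w - Q a, ∞)` the function `log u'` is Lipschitz with constant `A_u(w - Q a)`, because
  -- `A_u` is nonnegative and decreasing; so `φ₁` inherits absolute continuity from `Q`.
  have hac : AbsolutelyContinuousOnInterval φ₁ s t := by
    refine absolutelyContinuousOnInterval_of_dist_le (C := arrowPratt u (w - Q a)) hQst ?_
    rw [uIcc_of_le hst.le]
    intro x hx y hy
    have hmem : ∀ {z}, z ∈ Icc s t → w - Q z ∈ Ici (w - Q a) := fun hz => by
      have := hQm (hIcc (hsub hz)) (hIcc haI) (hsub hz).2
      simp only [mem_Ici]; linarith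
    have := (convex_Ici (w - Q a)).norm_image_sub_le_of_norm_hasDerivWithin_le
      (f := fun y => Real.log (deriv u y)) (f' := fun y => -arrowPratt u y)
      (C := arrowPratt u (w - Q a))
      (fun z hz => (hasDerivAt_log_deriv hu (hwa.trans_le hz)).hasDerivWithinAt)
      (fun z hz => by
        rw [norm_neg, Real.norm_of_nonneg (hAuNonneg z (hwa.trans_le hz))]
        exact hAu.antitoneOn (mem_Ioi.2 hwa) (mem_Ioi.2 (hwa.trans_le hz)) hz)
      (hmem hx) (hmem hy)
    rw [dist_comm (φ₁ x), dist_eq_norm]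
    refine this.trans_eq ?_
    rw [Real.dist_eq, Real.norm_eq_abs]
    congr 2; ring
  have hmono : MonotoneOn φ₂ (uIcc s t) := by
    rw [uIcc_of_le hst.le]
    intro x hx y hy hxy
    exact neg_le_neg (Real.log_le_log (hTpos y (hsub hy))
      (hTa.antitoneOn (hsub hx) (hsub hy) hxy))
  have h1 : ∫ x in s..t, deriv φ₁ x = φ₁ t - φ₁ s := hac.integral_deriv_eq_sub
  -- For `φ₂` monotonicity is enough: the integral of its derivative is at most its increment, which
  -- is the direction needed, so no regularity of `T''` enters.
  have h2 : ∫ x in s..t, deriv φ₂ x ≤ φ₂ t - φ₂ s := by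
    have h := hmono.intervalIntegral_deriv_mem_uIcc
    have h0 : φ₂ s ≤ φ₂ t := hmono left_mem_uIcc right_mem_uIcc hst.le
    rw [uIcc_of_le (sub_nonneg.2 h0)] at h
    exact h.2
  have h3 : 0 < ∫ x in s..t, (deriv φ₂ x - deriv φ₁ x) := by
    refine intervalIntegral_pos_of_ae_pos hst
      (hmono.intervalIntegrable_deriv.sub hac.intervalIntegrable_deriv) ?_
    filter_upwards [hQst.ae_differentiableAt] with x hx hxI
    have hxI' : x ∈ Icc s t := Ioo_subset_Icc_self hxI
    have hd := hx (by rw [uIcc_of_le hst.le]; exact hxI')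
    have hxa := hsub hxI'
    have e1 : deriv φ₁ x = arrowPratt u (w - Q x) * deriv Q x := by
      have := (hasDerivAt_log_deriv hu (hwpos x hxa)).comp x (hd.hasDerivAt.const_sub w)
      rw [show φ₁ = (fun y => Real.log (deriv u y)) ∘ fun y => w - Q y from rfl, this.deriv]
      ring
    have e2 : deriv φ₂ x = arrowPratt T x := by
      have := ((hT.deriv_differentiable x (hIoo hxa)).hasDerivAt.log (hTpos x hxa).ne').neg
      rw [show φ₂ = -fun y => Real.log (deriv T y) from rfl, this.deriv, arrowPratt, neg_div]
    rw [e1, e2, sub_pos]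
    refine lt_of_le_of_lt ?_ (hAT x hxa hd)
    have hQx := hQM x (hIcc hxa)
    -- `A_u` is only controlled at positive wealth. If `W - Q x = 0`, then `Q x` is the maximal
    -- value of `Q`, so `Q' x = 0` and both products vanish.
    rcases eq_or_lt_of_le (show 0 ≤ W - Q x by linarith) with h | h
    · have hmax : IsLocalMax Q x := by
        filter_upwards [Icc_mem_nhds (hIoo hxa).1 (hIoo hxa).2] with y hy
        linarith [hQM y hy]
      rw [hmax.deriv_eq_zero]; simp
    · have hQ' : 0 ≤ deriv Q x := by
        have h := hQm.derivWithin_nonneg (x := x)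
        rwa [derivWithin_of_mem_nhds (Icc_mem_nhds (hIoo hxa).1 (hIoo hxa).2)] at h
      exact mul_le_mul_of_nonneg_right
        (hAu.antitoneOn (mem_Ioi.2 h) (mem_Ioi.2 (hwpos x hxa)) (by linarith)) hQ'
  rw [intervalIntegral.integral_sub hmono.intervalIntegrable_deriv hac.intervalIntegrable_deriv]
    at h3
  have p1 := hu.deriv_pos (hwpos s hs)
  have p2 := hu.deriv_pos (hwpos t ht)
  show deriv u (w - Q t) * deriv T t < deriv u (w - Q s) * deriv T s
  rw [← Real.log_lt_log_iff (mul_pos p2 (hTpos t ht)) (mul_pos p1 (hTpos s hs)),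
    Real.log_mul p2.ne' (hTpos t ht).ne', Real.log_mul p1.ne' (hTpos s hs).ne']
  simp only [hφ₁, hφ₂] at h1 h2 h3
  linarith

end Decrease

/-! ### Quantiles of the loss and of its retained parts. -/

section Quantile

variable {Ω : Type*} [MeasurableSpace Ω] {P : Measure Ω} {X : Ω → ℝ} {M : ℝ}

theorem bddBelow_quantile_set (t : ℝ) (Y : Ω → ℝ) :
    BddBelow {x : ℝ | 0 ≤ x ∧ t ≤ cdfOf P Y x} := ⟨0, fun _ h => h.1⟩

theorem quantile_nonneg (t : ℝ) : 0 ≤ quantile P X t := Real.sInf_nonneg fun _ h => h.1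

theorem quantile_of_nonpos {t : ℝ} (ht : t ≤ 0) : quantile P X t = 0 := by
  refine le_antisymm (csInf_le (bddBelow_quantile_set t X) ⟨le_rfl, ?_⟩) (quantile_nonneg t)
  exact ht.trans measureReal_nonneg

variable [IsProbabilityMeasure P]

theorem cdfOf_eq_cdf (hX : Measurable X) (x : ℝ) :
    cdfOf P X x = ProbabilityTheory.cdf (P.map X) x := by
  have := Measure.isProbabilityMeasure_map (μ := P) hX.aemeasurable
  rw [ProbabilityTheory.cdf_eq_real, map_measureReal_apply hX measurableSet_Iic]
  rfl

theorem cdfOf_of_le (hX : IsLoss P X M) {x : ℝ} (hx : M ≤ x) : cdfOf P X x = 1 := by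
  have : P {ω | X ω ≤ x} = P univ :=
    measure_congr (eventuallyEq_univ.2 (hX.mem_Icc.mono fun ω h => h.2.trans hx))
  rw [cdfOf, measureReal_def, this]; simp

theorem quantile_le (hM : 0 < M) (hX : IsLoss P X M) {t : ℝ} (ht : t ≤ 1) : quantile P X t ≤ M :=
  csInf_le (bddBelow_quantile_set t X) ⟨hM.le, by rwa [cdfOf_of_le hX le_rfl]⟩

/-- Right continuity of the distribution function makes the infimum attained, giving a Galois
connection. -/
theorem quantile_le_iff (hM : 0 < M) (hX : IsLoss P X M) {t x : ℝ} (ht : t ≤ 1) (hx : 0 ≤ x) :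
    quantile P X t ≤ x ↔ t ≤ cdfOf P X x := by
  refine ⟨fun h => ?_, fun h => csInf_le (bddBelow_quantile_set t X) ⟨hx, h⟩⟩
  have hr : Tendsto (cdfOf P X) (𝓝[>] x) (𝓝 (cdfOf P X x)) := by
    have := ((ProbabilityTheory.cdf (P.map X)).right_continuous x).mono_left
      (nhdsWithin_mono x Ioi_subset_Ici_self)
    simpa only [← cdfOf_eq_cdf hX.measurable, funext_iff] using
      this.congr fun y => (cdfOf_eq_cdf hX.measurable y).symm
  refine ge_of_tendsto hr ?_
  filter_upwards [self_mem_nhdsWithin] with y hy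
  obtain ⟨z, hz, hzy⟩ := exists_lt_of_csInf_lt
    (⟨M, hM.le, by rwa [cdfOf_of_le hX le_rfl]⟩ : {x : ℝ | 0 ≤ x ∧ t ≤ cdfOf P X x}.Nonempty)
    (h.trans_lt hy)
  exact hz.2.trans (measureReal_mono fun ω hω => le_trans hω hzy.le)

theorem monotoneOn_quantile (hM : 0 < M) (hX : IsLoss P X M) :
    MonotoneOn (quantile P X) (Icc 0 1) := fun _ hs t ht hst =>
  (quantile_le_iff hM hX hs.2 (quantile_nonneg t)).2
    (hst.trans ((quantile_le_iff hM hX ht.2 (quantile_nonneg t)).1 le_rfl))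

/-- Quantiles of a retained loss. -/
theorem quantile_comp (hM : 0 < M) (hX : IsLoss P X M) {R : ℝ → ℝ} (hR : R ∈ retentions M)
    {t : ℝ} (ht : t ∈ Icc (0 : ℝ) 1) :
    quantile P (fun ω => R (X ω)) t = R (quantile P X t) := by
  set q := quantile P X t with hq
  have hq0 : 0 ≤ q := quantile_nonneg t
  have hqM : q ≤ M := quantile_le hM hX ht.2
  refine IsLeast.csInf_eq ⟨⟨?_, ?_⟩, fun x hx => ?_⟩
  · have := (hR.2 q 0 le_rfl hq0 hqM).1
    rw [hR.1] at this; linarith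
  · refine ((quantile_le_iff hM hX ht.2 hq0).1 le_rfl).trans ?_
    refine ENNReal.toReal_mono (measure_ne_top _ _) (measure_mono_ae ?_)
    filter_upwards [hX.mem_Icc] with ω hω hle
    have := (hR.2 q (X ω) hω.1 hle hqM).1
    show R (X ω) ≤ R q
    linarith
  -- If `x < R q`, there is `y < q` with `R y` strictly between them. Almost surely `R(X) ≤ x`
  -- forces `X ≤ y`, hence `t ≤ F_X(y)` and `q ≤ y`, a contradiction.
  · by_contra! hlt
    have hcont : ContinuousOn R (Icc 0 q) := by
      have : LipschitzOnWith 1 R (Icc 0 q) := LipschitzOnWith.of_dist_le_mul fun x hx y hy => by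
        rw [NNReal.coe_one, one_mul, Real.dist_eq, Real.dist_eq]
        rcases le_total x y with h | h
        · have := hR.2 y x hx.1 h (hy.2.trans hqM)
          rw [abs_sub_comm, abs_sub_comm x, abs_of_nonneg this.1, abs_of_nonneg (by linarith)]
          exact this.2
        · have := hR.2 x y hy.1 h (hx.2.trans hqM)
          rw [abs_of_nonneg this.1, abs_of_nonneg (by linarith)]
          exact this.2
      exact this.continuousOn
    obtain ⟨y, hy, hRy⟩ := intermediate_value_Ioo hq0 hcont
      (show (x + R q) / 2 ∈ Ioo (R 0) (R q) by
        rw [hR.1]; exact ⟨by linarith [hx.1], by linarith⟩)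
    have : q ≤ y := by
      refine (quantile_le_iff hM hX ht.2 hy.1.le).2 (hx.2.trans ?_)
      refine ENNReal.toReal_mono (measure_ne_top _ _) (measure_mono_ae ?_)
      filter_upwards [hX.mem_Icc] with ω hω hle
      by_contra! hc
      have hc : y < X ω := not_le.1 hc
      have hle : R (X ω) ≤ x := hle
      have := (hR.2 (X ω) y hy.1.le hc.le hω.2).1
      linarith
    linarith [hy.2]

/-- The quantile function pushes Lebesgue measure on `(0, 1]` forward to the law of `X`. -/
theorem integral_quantile (hM : 0 < M) (hX : IsLoss P X M) :
    ∫ t in (0 : ℝ)..1, quantile P X t = ∫ ω, X ω ∂P := by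
  have hmeas : AEMeasurable (quantile P X) (volume.restrict (Ioc (0 : ℝ) 1)) :=
    aemeasurable_restrict_of_monotoneOn measurableSet_Ioc
      ((monotoneOn_quantile hM hX).mono Ioc_subset_Icc_self)
  have hmap : (volume.restrict (Ioc (0 : ℝ) 1)).map (quantile P X) = P.map X := by
    have := Measure.isProbabilityMeasure_map (μ := P) hX.measurable.aemeasurable
    have hfin : IsFiniteMeasure (volume.restrict (Ioc (0 : ℝ) 1)) :=
      ⟨by simp⟩
    refine Measure.ext_of_Iic _ _ fun x => ?_
    rw [Measure.map_apply_of_aemeasurable hmeas measurableSet_Iic,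
      Measure.map_apply hX.measurable measurableSet_Iic]
    rcases lt_or_ge x 0 with hx | hx
    · have h1 : quantile P X ⁻¹' Iic x = ∅ := by
        ext t; simpa using hx.trans_le (quantile_nonneg t)
      have h2 : P (X ⁻¹' Iic x) = 0 := by
        refine measure_mono_null (fun ω hω => ?_) (ae_iff.1 hX.mem_Icc)
        exact fun h => absurd (h.1.trans hω) (not_le.2 hx)
      rw [h1, h2, measure_empty]
    · rw [Measure.restrict_apply' measurableSet_Ioc]
      have h1 : quantile P X ⁻¹' Iic x ∩ Ioc 0 1 = Ioc 0 (cdfOf P X x) := by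
        ext t
        have hle : cdfOf P X x ≤ 1 := measureReal_le_one
        constructor
        · rintro ⟨h, ht⟩
          exact ⟨ht.1, (quantile_le_iff hM hX ht.2 hx).1 h⟩
        · rintro ⟨h0, h⟩
          exact ⟨(quantile_le_iff hM hX (h.trans hle) hx).2 h, h0, h.trans hle⟩
      rw [h1, Real.volume_Ioc, sub_zero, cdfOf, ofReal_measureReal]
      rfl
  rw [intervalIntegral.integral_of_le zero_le_one]
  have h1 := integral_map hmeas (f := fun x : ℝ => x) aestronglyMeasurable_id
  have h2 := integral_map hX.measurable.aemeasurable (μ := P) (f := fun x : ℝ => x)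
    aestronglyMeasurable_id
  rw [← h1, hmap, h2]

end Quantile

/-! ### Sign and monotonicity of the first-order function `kFun`. -/

/-- The analytic data of the quantile problem: `Q` is the quantile function of the loss, `v` the
marginal utility, `a` and `c` the turning point and the unit point of the weighting `T`. -/
structure IsRegular (v T Q : ℝ → ℝ) (W M a c : ℝ) : Prop where
  inverseS : IsInverseS T
  turning : IsTurningPoint T a
  deriv_anti : StrictAntiOn (deriv T) (Ioc 0 a)
  deriv_turning : deriv T a = ratio T a
  unit : IsUnitPoint T a c
  ac : AbsolutelyContinuousOnInterval Q 0 1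
  mono : MonotoneOn Q (Icc 0 1)
  zero : Q 0 = 0
  le_M : ∀ t ∈ Icc (0 : ℝ) 1, Q t ≤ M
  cont_v : Continuous v
  anti_v : Antitone v
  pos_v : ∀ x, 0 < v x
  anti_mul : ∀ w, W ≤ w → 0 < w - Q a → StrictAntiOn (fun t => v (w - Q t) * deriv T t) (Ioc 0 a)
  dara : ∀ x y d, W - M ≤ x → x ≤ y → 0 ≤ d → v (x + d) * v y ≤ v (y + d) * v x

/-- `(z - y) v(w - Q(z)) (1 - T(z)) / (1 - z) - ∫_y^z v(w - Q(t)) T'(t) dt`. -/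
noncomputable def kFun (v T Q : ℝ → ℝ) (w y z : ℝ) : ℝ :=
  (z - y) * (v (w - Q z) * ratio T z) - ∫ t in y..z, v (w - Q t) * deriv T t

theorem intervalIntegrable_mul_deriv {T : ℝ → ℝ} (hT : IsInverseS T) {f : ℝ → ℝ}
    (hf : ContinuousOn f (Icc 0 1)) {s t : ℝ}
    (hs : s ∈ Icc (0 : ℝ) 1) (ht : t ∈ Icc (0 : ℝ) 1) :
    IntervalIntegrable (fun x => f x * deriv T x) volume s t :=
  (hT.intervalIntegrable_deriv hs ht).continuousOn_mul
    (hf.mono (ordConnected_Icc.uIcc_subset hs ht))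

namespace IsRegular

variable {v T Q : ℝ → ℝ} {W M a c : ℝ} (h : IsRegular v T Q W M a c)

include h

theorem continuousOn : ContinuousOn Q (Icc 0 1) := by
  have := h.ac.continuousOn
  rwa [uIcc_of_le zero_le_one] at this

theorem a_mem : a ∈ Icc (0 : ℝ) 1 := Ioo_subset_Icc_self h.turning.1

theorem nonneg {t : ℝ} (ht : t ∈ Icc (0 : ℝ) 1) : 0 ≤ Q t := by
  rw [← h.zero]; exact h.mono (left_mem_Icc.2 zero_le_one) ht ht.1

theorem ratio_le_one {y : ℝ} (hy : y ∈ Icc 0 a) : ratio T y ≤ 1 := by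
  rw [← ratio_zero h.inverseS]
  exact h.turning.2.1.antitoneOn ⟨le_rfl, h.turning.1.1.le⟩ hy hy.1

theorem continuousOn_v (w : ℝ) : ContinuousOn (fun t => v (w - Q t)) (Icc 0 1) :=
  h.cont_v.comp_continuousOn (continuousOn_const.sub h.continuousOn)

theorem intervalIntegrable (w : ℝ) {s t : ℝ} (hs : s ∈ Icc (0 : ℝ) 1) (ht : t ∈ Icc (0 : ℝ) 1) :
    IntervalIntegrable (fun x => v (w - Q x) * deriv T x) volume s t :=
  intervalIntegrable_mul_deriv h.inverseS (h.continuousOn_v w) hs ht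

/-- `v(w - Q)` is nondecreasing, so it is largest at the right end point. -/
theorem integral_le (w : ℝ) {y z : ℝ} (hy : 0 ≤ y) (hyz : y ≤ z) (hz : z ≤ 1) :
    ∫ t in y..z, v (w - Q t) * deriv T t ≤ v (w - Q z) * (T z - T y) := by
  have hyI : y ∈ Icc (0 : ℝ) 1 := ⟨hy, hyz.trans hz⟩
  have hzI : z ∈ Icc (0 : ℝ) 1 := ⟨hy.trans hyz, hz⟩
  rw [← h.inverseS.integral_deriv hyI hzI hyz, ← intervalIntegral.integral_const_mul]
  refine intervalIntegral.integral_mono_on_of_le_Ioo hyz (h.intervalIntegrable w hyI hzI)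
    ((h.inverseS.intervalIntegrable_deriv hyI hzI).const_mul _) fun x hx => ?_
  refine mul_le_mul_of_nonneg_right (h.anti_v ?_)
    (h.inverseS.deriv_nonneg ⟨hy.trans_lt hx.1, hx.2.trans_le hz⟩)
  linarith [h.mono ⟨hy.trans hx.1.le, hx.2.le.trans hz⟩ hzI hx.2.le]

/-- After freezing `v` at its largest value, what remains is `(z - y) * ratio T z - (T z - T y)`,
which equals `(1 - y) * (ratio T z - ratio T y)`. Thus an increase of `ratio T` forces `k ≥ 0`. -/
theorem le_kFun (w : ℝ) {y z : ℝ} (hy : 0 ≤ y) (hyz : y ≤ z) (hz : z < 1) :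
    v (w - Q z) * ((1 - y) * (ratio T z - ratio T y)) ≤ kFun v T Q w y z := by
  have h1 := h.integral_le w hy hyz hz.le
  have e : (1 - y) * (ratio T z - ratio T y) = (z - y) * ratio T z - (T z - T y) := by
    have e1 := ratio_mul (T := T) hz
    have e2 := ratio_mul (T := T) (hyz.trans_lt hz)
    linear_combination e1 - e2
  rw [kFun, e]
  linarith

/-- Moving `z` to the right of `a` raises both factors of the multiplier; the added piece of the
integral is at most `v(w - Q z') * (T z' - T z)`, and the net gain is at least `v(w - Q z') * (1 -
y) * (ratio T z' - ratio T z)`. -/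
theorem kFun_lt (w : ℝ) {y z z' : ℝ} (hy : 0 ≤ y) (hyz : y ≤ z) (haz : a ≤ z) (hzz : z < z')
    (hz : z' < 1) : kFun v T Q w y z < kFun v T Q w y z' := by
  have hyI : y ∈ Icc (0 : ℝ) 1 := ⟨hy, (hyz.trans_lt (hzz.trans hz)).le⟩
  have hzI : z ∈ Icc (0 : ℝ) 1 := ⟨hy.trans hyz, (hzz.trans hz).le⟩
  have hzI' : z' ∈ Icc (0 : ℝ) 1 := ⟨hzI.1.trans hzz.le, hz.le⟩
  have h1 := h.integral_le w hzI.1 hzz.le hz.le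
  have h2 := intervalIntegral.integral_add_adjacent_intervals (h.intervalIntegrable w hyI hzI)
    (h.intervalIntegrable w hzI hzI')
  have e1 := ratio_mul (T := T) hz
  have e2 := ratio_mul (T := T) (hzz.trans hz)
  have hr : ratio T z < ratio T z' := h.turning.2.2 ⟨haz, hzz.trans hz⟩ ⟨haz.trans hzz.le, hz⟩ hzz
  have hv : v (w - Q z) ≤ v (w - Q z') := h.anti_v (by linarith [h.mono hzI hzI' hzz.le])
  have h3 : v (w - Q z) * ((z - y) * ratio T z) ≤ v (w - Q z') * ((z - y) * ratio T z) :=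
    mul_le_mul_of_nonneg_right hv
      (mul_nonneg (by linarith) (ratio_pos h.inverseS hzI.1 (hzz.trans hz)).le)
  have h4 : 0 < v (w - Q z') * ((1 - y) * (ratio T z' - ratio T z)) :=
    mul_pos (h.pos_v _) (mul_pos (by linarith) (by linarith))
  have h5 : v (w - Q z') * ((1 - y) * (ratio T z' - ratio T z)) =
      v (w - Q z') * ((z' - y) * ratio T z') - v (w - Q z') * ((z - y) * ratio T z)
        - v (w - Q z') * (T z' - T z) := by
    linear_combination v (w - Q z') * (e1 - e2)
  rw [kFun, kFun]
  linarith

/-- Since `ratio T a = T' a`, the multiplier at `z = a` is the final, hence smallest, value of the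
decreasing integrand. -/
theorem kFun_turning_neg {w y : ℝ} (hw : W ≤ w) (hwa : 0 < w - Q a) (hy : 0 ≤ y) (hya : y < a) :
    kFun v T Q w y a < 0 := by
  have hyI : y ∈ Icc (0 : ℝ) 1 := ⟨hy, hya.le.trans h.a_mem.2⟩
  have hi := h.intervalIntegrable w hyI h.a_mem
  have := intervalIntegral.intervalIntegral_pos_of_pos_on
    (f := fun t => v (w - Q t) * deriv T t - v (w - Q a) * deriv T a) (a := y) (b := a)
    (hi.sub intervalIntegrable_const)
    (fun x hx => sub_pos.2 (h.anti_mul w hw hwa ⟨hy.trans_lt hx.1, hx.2.le⟩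
      ⟨h.turning.1.1, le_rfl⟩ hx.2)) hya
  rw [intervalIntegral.integral_sub hi intervalIntegrable_const,
    intervalIntegral.integral_const, smul_eq_mul, h.deriv_turning] at this
  rw [kFun]
  linarith

theorem continuousOn_kFun (w : ℝ) {y : ℝ} (hy : y ∈ Icc (0 : ℝ) 1) :
    ContinuousOn (kFun v T Q w y) (Ico 0 1) := by
  have h1 := intervalIntegral.continuousOn_primitive_interval' (μ := volume) (a := y)
    (h.intervalIntegrable w (left_mem_Icc.2 zero_le_one) (right_mem_Icc.2 zero_le_one))
    (by rwa [uIcc_of_le zero_le_one])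
  rw [uIcc_of_le zero_le_one] at h1
  refine ContinuousOn.sub (ContinuousOn.mul (by fun_prop) (ContinuousOn.mul
    ((h.continuousOn_v w).mono Ico_subset_Icc_self) (continuousOn_ratio h.inverseS)))
    (h1.mono Ico_subset_Icc_self)

theorem kFun_unit_nonneg (w : ℝ) {y : ℝ} (hy : y ∈ Icc 0 a) : 0 ≤ kFun v T Q w y c := by
  refine le_trans ?_ (h.le_kFun w hy.1 (hy.2.trans h.unit.1.1.le) h.unit.1.2)
  rw [h.unit.2]
  exact mul_nonneg (h.pos_v _).le (mul_nonneg (by linarith [hy.2, h.turning.1.2])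
    (by linarith [h.ratio_le_one hy]))

theorem exists_kFun_eq_zero {w y : ℝ} (hw : W ≤ w) (hwa : 0 < w - Q a) (hy : y ∈ Icc 0 a) :
    ∃ z ∈ Icc a c, kFun v T Q w y z = 0 := by
  have hle : kFun v T Q w y a ≤ 0 := by
    rcases eq_or_lt_of_le hy.2 with e | hlt
    · simp [kFun, e]
    · exact (h.kFun_turning_neg hw hwa hy.1 hlt).le
  have := intermediate_value_Icc h.unit.1.1.le
    ((h.continuousOn_kFun w ⟨hy.1, hy.2.trans h.a_mem.2⟩).mono
      fun z hz => ⟨h.a_mem.1.trans hz.1, hz.2.trans_lt h.unit.1.2⟩)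
    (show (0 : ℝ) ∈ Icc _ _ from ⟨hle, h.kFun_unit_nonneg w hy⟩)
  obtain ⟨z, hz, e⟩ := this
  exact ⟨z, hz, e⟩

theorem kFun_strictMonoOn (w : ℝ) {y : ℝ} (hy : y ∈ Icc 0 a) :
    StrictMonoOn (kFun v T Q w y) (Ico a 1) := fun _ hz _ hz' hzz =>
  h.kFun_lt w hy.1 (hy.2.trans hz.1) hz.1 hzz hz'.2

/-- `k ≥ 0` at the left end point propagates to the whole interval. -/
theorem kFun_nonneg_of_nonneg {w y z : ℝ} (hw : W ≤ w) (hwa : 0 < w - Q a) (hy : y ∈ Icc 0 a)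
    (hz : z ∈ Ico a 1) (hk : 0 ≤ kFun v T Q w y z) {t : ℝ} (ht : t ∈ Icc y z) :
    0 ≤ kFun v T Q w t z := by
  -- To the right of `a`, `ratio T` increases, so `le_kFun` applies directly.
  have hupper : ∀ s ∈ Icc a z, 0 ≤ kFun v T Q w s z := fun s hs => by
    refine le_trans ?_ (h.le_kFun w (h.a_mem.1.trans hs.1) hs.2 hz.2)
    have := h.turning.2.2.monotoneOn ⟨hs.1, hs.2.trans_lt hz.2⟩ hz hs.2
    exact mul_nonneg (h.pos_v _).le (mul_nonneg (by linarith [hs.2, hz.2]) (by linarith))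
  rcases le_or_gt a t with hat | hta
  · exact hupper t ⟨hat, ht.2⟩
  have hyI : y ∈ Icc (0 : ℝ) 1 := ⟨hy.1, hy.2.trans h.a_mem.2⟩
  have htI : t ∈ Icc (0 : ℝ) 1 := ⟨hy.1.trans ht.1, hta.le.trans h.a_mem.2⟩
  have hzI : z ∈ Icc (0 : ℝ) 1 := ⟨h.a_mem.1.trans hz.1, hz.2.le⟩
  have hanti := (h.anti_mul w hw hwa).antitoneOn
  set l := v (w - Q z) * ratio T z with hl
  rcases eq_or_lt_of_le ht.1 with e | hyt
  · rwa [← e]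
  have htm : t ∈ Ioc 0 a := ⟨hy.1.trans_lt hyt, hta.le⟩
  -- The integrand decreases on `(0, a]`. If it is at most `l` at `t`, it stays so on `[t, a]`, and
  -- `k` at `t` is at least `k` at `a`. Otherwise it is at least `l` on `(y, t)`, and dropping that
  -- piece cannot lower `k`.
  rcases le_total (v (w - Q t) * deriv T t) l with hc | hc
  · have h1 := hupper a ⟨le_rfl, hz.1⟩
    have h2 : ∫ s in t..a, v (w - Q s) * deriv T s ≤ ∫ _ in t..a, l :=
      intervalIntegral.integral_mono_on hta.le (h.intervalIntegrable w htI h.a_mem)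
        intervalIntegrable_const fun s hs =>
          (hanti htm ⟨htm.1.trans_le hs.1, hs.2⟩ hs.1).trans hc
    rw [intervalIntegral.integral_const, smul_eq_mul] at h2
    have h3 := intervalIntegral.integral_add_adjacent_intervals
      (h.intervalIntegrable w htI h.a_mem) (h.intervalIntegrable w h.a_mem hzI)
    rw [kFun, ← hl] at h1 ⊢
    nlinarith
  · have h2 : ∫ _ in y..t, l ≤ ∫ s in y..t, v (w - Q s) * deriv T s :=
      intervalIntegral.integral_mono_on_of_le_Ioo hyt.le intervalIntegrable_const
        (h.intervalIntegrable w hyI htI) fun s hs =>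
          hc.trans (hanti ⟨hy.1.trans_lt hs.1, hs.2.le.trans hta.le⟩ htm hs.2.le)
    rw [intervalIntegral.integral_const, smul_eq_mul] at h2
    have h3 := intervalIntegral.integral_add_adjacent_intervals
      (h.intervalIntegrable w hyI htI) (h.intervalIntegrable w htI hzI)
    rw [kFun, ← hl] at hk ⊢
    nlinarith

/-- If `k = 0`, the multiplier lies below the weighted marginal utility at the left end point. -/
theorem multiplier_le {w y z : ℝ} (hw : W ≤ w) (hwa : 0 < w - Q a) (hy : y ∈ Ioc 0 a)
    (hz : z ∈ Ico a 1) (hk : kFun v T Q w y z = 0) :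
    v (w - Q z) * ratio T z ≤ v (w - Q y) * deriv T y := by
  have hyI : y ∈ Icc (0 : ℝ) 1 := ⟨hy.1.le, hy.2.trans h.a_mem.2⟩
  have hzI : z ∈ Icc (0 : ℝ) 1 := ⟨h.a_mem.1.trans hz.1, hz.2.le⟩
  rcases eq_or_lt_of_le hy.2 with e | hya
  · subst e
    rcases eq_or_lt_of_le hz.1 with e | hyz
    · rw [← e, h.deriv_turning]
    · have := h.kFun_lt w hy.1.le le_rfl le_rfl hyz hz.2
      simp [kFun] at this hk
      linarith
  -- Were the integrand below the multiplier at `y`, it would be so on `[y, a]`, and `k` at `y`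
  -- would strictly exceed `k` at `a`, which is nonnegative.
  by_contra! hc
  have hka := h.kFun_nonneg_of_nonneg hw hwa (Ioc_subset_Icc_self hy) hz hk.ge
    (t := a) ⟨hy.2, hz.1⟩
  set l := v (w - Q z) * ratio T z with hl
  have hanti := (h.anti_mul w hw hwa).antitoneOn
  have h2 : ∫ s in y..a, v (w - Q s) * deriv T s ≤ ∫ _ in y..a, v (w - Q y) * deriv T y :=
    intervalIntegral.integral_mono_on hya.le (h.intervalIntegrable w hyI h.a_mem)
      intervalIntegrable_const fun s hs => hanti hy ⟨hy.1.trans_le hs.1, hs.2⟩ hs.1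
  rw [intervalIntegral.integral_const, smul_eq_mul] at h2
  have h3 := intervalIntegral.integral_add_adjacent_intervals
      (h.intervalIntegrable w hyI h.a_mem) (h.intervalIntegrable w h.a_mem hzI)
  have h4 := mul_lt_mul_of_pos_left hc (sub_pos.2 hya)
  rw [kFun, ← hl] at hk hka
  nlinarith

/-- Decreasing absolute risk aversion: nonnegativity of `k` is inherited by lower wealth. -/
theorem kFun_nonneg_of_le {w w' z : ℝ} (hw : W ≤ w) (hww : w ≤ w') (hz : z ∈ Ico (0 : ℝ) 1)
    (hk : 0 ≤ kFun v T Q w' 0 z) : 0 ≤ kFun v T Q w 0 z := by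
  have h0 : (0 : ℝ) ∈ Icc (0 : ℝ) 1 := left_mem_Icc.2 zero_le_one
  have hzI : z ∈ Icc (0 : ℝ) 1 := Ico_subset_Icc_self hz
  -- The cross-multiplied comparison of `v(w - Q t) / v(w - Q z)` with its value at `w'`, integrated
  -- against `T'`. It gives `v(w - Q z) * k_{w'} ≤ v(w' - Q z) * k_w`.
  have h1 : ∫ t in (0 : ℝ)..z, v (w' - Q z) * (v (w - Q t) * deriv T t) ≤
      ∫ t in (0 : ℝ)..z, v (w - Q z) * (v (w' - Q t) * deriv T t) := by
    refine intervalIntegral.integral_mono_on_of_le_Ioo hz.1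
      ((h.intervalIntegrable w h0 hzI).const_mul _)
      ((h.intervalIntegrable w' h0 hzI).const_mul _) fun t ht => ?_
    have htI : t ∈ Icc (0 : ℝ) 1 := ⟨ht.1.le, (ht.2.trans hz.2).le⟩
    have hd := h.dara (w - Q z) (w' - Q z) (Q z - Q t) (by linarith [h.le_M z hzI])
      (by linarith) (by linarith [h.mono htI hzI ht.2.le])
    rw [sub_add_sub_cancel, sub_add_sub_cancel] at hd
    have hT := h.inverseS.deriv_nonneg ⟨ht.1, ht.2.trans hz.2⟩
    nlinarith
  rw [intervalIntegral.integral_const_mul, intervalIntegral.integral_const_mul] at h1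
  have p := h.pos_v (w - Q z)
  have p' := h.pos_v (w' - Q z)
  have h2 : 0 ≤ v (w - Q z) * kFun v T Q w' 0 z := mul_nonneg p.le hk
  have h3 : v (w - Q z) * kFun v T Q w' 0 z ≤ v (w' - Q z) * kFun v T Q w 0 z := by
    rw [kFun, kFun]
    nlinarith
  exact nonneg_of_mul_nonneg_right (h2.trans h3) p'

/-- Here `y` enters through the lower limit and the wealth at once. Replacing `Q t - Q y` by its
positive part extends the integral to `[0, z]`, the piece below `y` contributing `v w * T y`;
dominated convergence in the parameter `s = Q y` then applies. -/
theorem continuousOn_kFun_left (w : ℝ) {z : ℝ} (hz : z ∈ Ico a 1) :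
    ContinuousOn (fun y => kFun v T Q (w + Q y) y z) (Icc 0 a) := by
  have h0 : (0 : ℝ) ∈ Icc (0 : ℝ) 1 := left_mem_Icc.2 zero_le_one
  have hzI : z ∈ Icc (0 : ℝ) 1 := ⟨h.a_mem.1.trans hz.1, hz.2.le⟩
  have hsub : Icc 0 a ⊆ Icc (0 : ℝ) 1 := Icc_subset_Icc_right h.a_mem.2
  have hcont : ∀ s, ContinuousOn (fun t => v (w - max (Q t - s) 0)) (Icc 0 1) := fun s =>
    h.cont_v.comp_continuousOn
      (continuousOn_const.sub ((h.continuousOn.sub continuousOn_const).sup continuousOn_const))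
  -- The inner `max s 0` makes the dominating function `v(w - M) * T'` valid for every real `s`; it
  -- changes nothing at `s = Q y ≥ 0`.
  have hint : Continuous fun s =>
      ∫ t in (0 : ℝ)..z, v (w - max (Q t - max s 0) 0) * deriv T t := by
    refine intervalIntegral.continuous_of_dominated_interval
      (bound := fun t => v (w - M) * deriv T t) (fun s => ?_) (fun s => ?_)
      ((h.inverseS.intervalIntegrable_deriv h0 hzI).const_mul _) ?_
    · exact (intervalIntegrable_mul_deriv h.inverseS (hcont (max s 0))
        h0 hzI).aestronglyMeasurable_restrict_uIoc
    · refine Eventually.of_forall fun t ht => ?_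
      rw [uIoc_of_le hzI.1] at ht
      have hT := h.inverseS.deriv_nonneg ⟨ht.1, ht.2.trans_lt hz.2⟩
      have htI : t ∈ Icc (0 : ℝ) 1 := ⟨ht.1.le, ht.2.trans hzI.2⟩
      rw [Real.norm_of_nonneg (mul_nonneg (h.pos_v _).le hT)]
      refine mul_le_mul_of_nonneg_right (h.anti_v ?_) hT
      have : max (Q t - max s 0) 0 ≤ M :=
        max_le (by linarith [h.le_M t htI, le_max_right s 0]) ((h.nonneg htI).trans (h.le_M t htI))
      linarith
    · refine Eventually.of_forall fun t _ => ?_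
      exact (h.cont_v.comp (by fun_prop)).mul continuous_const
  have heq : ∀ y ∈ Icc 0 a, kFun v T Q (w + Q y) y z =
      (z - y) * (v (w + Q y - Q z) * ratio T z)
        - ((∫ t in (0 : ℝ)..z, v (w - max (Q t - Q y) 0) * deriv T t) - v w * T y) := by
    intro y hy
    have hyz := hy.2.trans hz.1
    rw [kFun, ← intervalIntegral.integral_add_adjacent_intervals
      (intervalIntegrable_mul_deriv h.inverseS (hcont (Q y)) h0 (hsub hy))
      (intervalIntegrable_mul_deriv h.inverseS (hcont (Q y)) (hsub hy) hzI)]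
    have e1 : ∫ t in (0 : ℝ)..y, v (w - max (Q t - Q y) 0) * deriv T t = v w * T y := by
      have : ∫ t in (0 : ℝ)..y, v w * deriv T t = v w * T y := by
        rw [intervalIntegral.integral_const_mul,
          h.inverseS.integral_deriv h0 (hsub hy) hy.1, h.inverseS.map_zero, sub_zero]
      rw [← this]
      refine intervalIntegral.integral_congr fun t ht => ?_
      rw [uIcc_of_le hy.1] at ht
      have := h.mono ⟨ht.1, ht.2.trans (hsub hy).2⟩ (hsub hy) ht.2
      simp only [max_eq_right (sub_nonpos.2 this), sub_zero]
    have e2 : ∫ t in y..z, v (w - max (Q t - Q y) 0) * deriv T t =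
        ∫ t in y..z, v (w + Q y - Q t) * deriv T t := by
      refine intervalIntegral.integral_congr fun t ht => ?_
      rw [uIcc_of_le hyz] at ht
      have := h.mono (hsub hy) ⟨hy.1.trans ht.1, ht.2.trans hzI.2⟩ ht.1
      simp only [max_eq_left (sub_nonneg.2 this)]
      congr 2; ring
    rw [e1, e2]; ring
  refine ContinuousOn.congr ?_ heq
  have hQ := h.continuousOn.mono hsub
  have hTc := h.inverseS.continuousOn.mono hsub
  have c1 : ContinuousOn (fun y => v (w + Q y - Q z)) (Icc 0 a) :=
    h.cont_v.comp_continuousOn (by fun_prop)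
  have c2 : ContinuousOn (fun y => ∫ t in (0 : ℝ)..z, v (w - max (Q t - Q y) 0) * deriv T t)
      (Icc 0 a) := by
    refine (hint.comp_continuousOn hQ).congr fun y hy => ?_
    simp only [Function.comp, max_eq_left (h.nonneg (hsub hy))]
  exact ((continuousOn_const.sub continuousOn_id).mul (c1.mul continuousOn_const)).sub
    (c2.sub (continuousOn_const.mul hTc))

end IsRegular

/-! ### Functions whose increments are dominated by those of `Q`. -/

/-- `H` is a quantile function of a retained part of the loss with quantile function `Q`. -/
def IsRetentionOf (Q H : ℝ → ℝ) : Prop :=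
  H 0 = 0 ∧ ∀ s t, 0 ≤ s → s ≤ t → t ≤ 1 → 0 ≤ H t - H s ∧ H t - H s ≤ Q t - Q s

namespace IsRetentionOf

variable {Q H : ℝ → ℝ}

theorem absolutelyContinuous (hH : IsRetentionOf Q H)
    (hQ : AbsolutelyContinuousOnInterval Q 0 1) : AbsolutelyContinuousOnInterval H 0 1 := by
  refine absolutelyContinuousOnInterval_of_dist_le (C := 1) hQ ?_
  rw [uIcc_of_le zero_le_one]
  intro x hx y hy
  rw [one_mul, Real.dist_eq, Real.dist_eq]
  rcases le_total x y with hxy | hxy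
  · have := hH.2 x y hx.1 hxy hy.2
    rw [abs_sub_comm, abs_sub_comm (Q x), abs_of_nonneg this.1,
      abs_of_nonneg (this.1.trans this.2)]
    exact this.2
  · have := hH.2 y x hy.1 hxy hx.2
    rw [abs_of_nonneg this.1, abs_of_nonneg (this.1.trans this.2)]
    exact this.2

theorem continuousOn (hH : IsRetentionOf Q H)
    (hQ : AbsolutelyContinuousOnInterval Q 0 1) : ContinuousOn H (Icc 0 1) := by
  have := (hH.absolutelyContinuous hQ).continuousOn
  rwa [uIcc_of_le zero_le_one] at this

theorem nonneg (hH : IsRetentionOf Q H) {t : ℝ} (ht : t ∈ Icc (0 : ℝ) 1) : 0 ≤ H t := by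
  have := (hH.2 0 t le_rfl ht.1 ht.2).1
  rw [hH.1] at this; linarith

theorem le (hH : IsRetentionOf Q H) (h0 : Q 0 = 0) {t : ℝ} (ht : t ∈ Icc (0 : ℝ) 1) :
    H t ≤ Q t := by
  have := (hH.2 0 t le_rfl ht.1 ht.2).2
  rw [hH.1, h0] at this; linarith

theorem deriv_mem (hH : IsRetentionOf Q H) {x : ℝ} (hx : x ∈ Ioo (0 : ℝ) 1)
    (hQ : DifferentiableAt ℝ Q x) (hd : DifferentiableAt ℝ H x) :
    0 ≤ deriv H x ∧ deriv H x ≤ deriv Q x := by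
  have hnhds := Icc_mem_nhds hx.1 hx.2
  constructor
  · have hm : MonotoneOn H (Icc 0 1) := fun s hs t ht hst => by
      linarith [(hH.2 s t hs.1 hst ht.2).1]
    have h := hm.derivWithin_nonneg (x := x)
    rwa [derivWithin_of_mem_nhds hnhds] at h
  · have hm : MonotoneOn (Q - H) (Icc 0 1) := fun s hs t ht hst => by
      have := (hH.2 s t hs.1 hst ht.2).2
      simp only [Pi.sub_apply]; linarith
    have h := hm.derivWithin_nonneg (x := x)
    rw [derivWithin_of_mem_nhds hnhds, deriv_sub hQ hd] at h
    linarith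

end IsRetentionOf

/-! ### Sufficiency of the first-order condition. -/

section Verification

/-- Integration by parts for two retained quantile functions. -/
theorem integral_mul_sub_nonpos {Q G H p : ℝ → ℝ} (hQ : AbsolutelyContinuousOnInterval Q 0 1)
    (hG : IsRetentionOf Q G) (hH : IsRetentionOf Q H) (hp : IntervalIntegrable p volume 0 1)
    (hsign : ∀ᵐ x, x ∈ Ioo (0 : ℝ) 1 → DifferentiableAt ℝ Q x → DifferentiableAt ℝ H x →
      0 ≤ (∫ s in (1 : ℝ)..x, p s) * (deriv G x - deriv H x)) :
    ∫ x in (0 : ℝ)..1, p x * (G x - H x) ≤ 0 := by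
  have hGa := hG.absolutelyContinuous hQ
  have hHa := hH.absolutelyContinuous hQ
  -- Basing the primitive at `1` kills the boundary term there; at `0` both `G` and `H` vanish.
  have hN := hp.absolutelyContinuousOnInterval_intervalIntegral (c := 1) (by simp)
  have hparts := hN.integral_mul_deriv_eq_deriv_mul (hGa.fun_sub hHa)
  have e1 : ∫ x in (0 : ℝ)..1, deriv (fun x => ∫ s in (1 : ℝ)..x, p s) x * (G x - H x) =
      ∫ x in (0 : ℝ)..1, p x * (G x - H x) := by
    refine intervalIntegral.integral_congr_ae ?_
    filter_upwards [hp.ae_hasDerivAt_integral] with x hx hxI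
    rw [(hx (uIoc_subset_uIcc hxI) 1 (by simp)).deriv]
  have e2 : 0 ≤ ∫ x in (0 : ℝ)..1,
      (∫ s in (1 : ℝ)..x, p s) * deriv (fun x => G x - H x) x := by
    refine intervalIntegral.integral_nonneg_of_ae_restrict zero_le_one ?_
    refine ae_restrict_of_ae_eq_of_ae_restrict Ioo_ae_eq_Icc ?_
    refine (ae_restrict_iff' measurableSet_Ioo).2 ?_
    filter_upwards [hsign, hQ.ae_differentiableAt, hGa.ae_differentiableAt,
      hHa.ae_differentiableAt] with x h1 h2 h3 h4 hx
    have hxI : x ∈ uIcc (0 : ℝ) 1 := by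
      rw [uIcc_of_le zero_le_one]; exact Ioo_subset_Icc_self hx
    rw [deriv_fun_sub (h3 hxI) (h4 hxI)]
    exact h1 hx (h2 hxI) (h4 hxI)
  rw [e1] at hparts
  simp only [intervalIntegral.integral_same, zero_mul, hG.1, hH.1, sub_self, mul_zero] at hparts
  linarith

variable {u T Q : ℝ → ℝ} {M : ℝ}

theorem ae_mul_deriv_nonneg (hT : IsInverseS T) {S : ℝ → ℝ}
    (hS : ∀ z ∈ Icc (0 : ℝ) 1, 0 ≤ S z) :
    0 ≤ᵐ[volume.restrict (Ioc (0 : ℝ) 1)] fun z => S z * deriv T z := by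
  refine ae_restrict_of_ae_eq_of_ae_restrict Ioo_ae_eq_Ioc ?_
  refine (ae_restrict_iff' measurableSet_Ioo).2 ?_
  exact Eventually.of_forall fun z hz =>
    mul_nonneg (hS z (Ioo_subset_Icc_self hz)) (hT.deriv_nonneg hz)

theorem integral_mul_deriv_nonneg (hT : IsInverseS T) {S : ℝ → ℝ}
    (hS : ∀ z ∈ Icc (0 : ℝ) 1, 0 ≤ S z) : 0 ≤ ∫ z in (0 : ℝ)..1, S z * deriv T z :=
  intervalIntegral.integral_nonneg_of_ae_restrict zero_le_one
    (ae_restrict_of_ae_eq_of_ae_restrict Ioc_ae_eq_Icc (ae_mul_deriv_nonneg hT hS))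

/-- `T'` is positive on `(0, 1)` apart from at most one point, so `S` vanishes almost everywhere,
hence everywhere by continuity. This is the source of uniqueness. -/
theorem eq_zero_of_integral_mul_deriv_eq_zero (hT : IsInverseS T) {S : ℝ → ℝ}
    (hScont : ContinuousOn S (Icc 0 1)) (hS : ∀ z ∈ Icc (0 : ℝ) 1, 0 ≤ S z)
    (hzero : ∫ z in (0 : ℝ)..1, S z * deriv T z = 0) : ∀ z ∈ Icc (0 : ℝ) 1, S z = 0 := by
  have iS := intervalIntegrable_mul_deriv hT hScont (left_mem_Icc.2 zero_le_one)
    (right_mem_Icc.2 zero_le_one)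
  rw [intervalIntegral.integral_of_le zero_le_one,
    integral_eq_zero_iff_of_nonneg_ae (ae_mul_deriv_nonneg hT hS) iS.1] at hzero
  obtain ⟨b, hb⟩ := hT.exists_deriv_pos
  have haeq : S =ᵐ[volume.restrict (Icc (0 : ℝ) 1)] fun _ => 0 := by
    refine ae_restrict_of_ae_eq_of_ae_restrict Ioc_ae_eq_Icc ?_
    filter_upwards [hzero, ae_restrict_mem measurableSet_Ioc,
      ae_restrict_of_ae ((Set.toFinite ({1, b} : Set ℝ)).countable.ae_notMem volume)]
      with z hz hzI hzn
    simp only [mem_insert_iff, mem_singleton_iff, not_or] at hzn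
    have hT' := hb z ⟨hzI.1, lt_of_le_of_ne hzI.2 hzn.1⟩ hzn.2
    exact (mul_eq_zero.1 hz).resolve_right hT'.ne'
  exact fun z hz => Measure.eqOn_Icc_of_ae_eq volume zero_ne_one haeq hScont continuousOn_const hz

/-- Sufficient first-order condition with multiplier `l`. -/
theorem objective_le {w l : ℝ} {G H : ℝ → ℝ} (hu : IsStrictlyConcaveUtility u)
    (hT : IsInverseS T) (hQ : AbsolutelyContinuousOnInterval Q 0 1) (hQ0 : Q 0 = 0)
    (hQM : ∀ t ∈ Icc (0 : ℝ) 1, Q t ≤ M) (hwM : 0 < w - M)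
    (hG : IsRetentionOf Q G) (hH : IsRetentionOf Q H) (hl : 0 ≤ l)
    (hGH : ∫ z in (0 : ℝ)..1, G z ≤ ∫ z in (0 : ℝ)..1, H z)
    (hle : ∫ x in (0 : ℝ)..1, (deriv u (w - G x) * deriv T x - l) * (G x - H x) ≤ 0) :
    objective u T w H ≤ objective u T w G ∧
      (objective u T w H = objective u T w G → ∀ z ∈ Icc (0 : ℝ) 1, H z = G z) := by
  have h0 : (0 : ℝ) ∈ Icc (0 : ℝ) 1 := left_mem_Icc.2 zero_le_one
  have h1 : (1 : ℝ) ∈ Icc (0 : ℝ) 1 := right_mem_Icc.2 zero_le_one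
  have hGc := hG.continuousOn hQ
  have hHc := hH.continuousOn hQ
  have hpos : ∀ {K : ℝ → ℝ}, IsRetentionOf Q K → ∀ z ∈ Icc (0 : ℝ) 1, 0 < w - K z :=
    fun hK z hz => by linarith [hK.le hQ0 hz, hQM z hz]
  have hucont : ∀ {K : ℝ → ℝ}, IsRetentionOf Q K →
      ContinuousOn (fun z => u (w - K z)) (Icc 0 1) := fun {K} hK z hz =>
    ((hu.differentiable _ (hpos hK z hz)).continuousAt).comp_continuousWithinAt
      (f := fun z => w - K z) (continuousWithinAt_const.sub (hK.continuousOn hQ z hz))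
  have hdcont : ContinuousOn (fun z => deriv u (w - G z)) (Icc 0 1) := fun z hz =>
    ((hu.deriv_differentiable _ (hpos hG z hz)).continuousAt).comp_continuousWithinAt
      (f := fun z => w - G z) (continuousWithinAt_const.sub (hGc z hz))
  -- The gap in the tangent inequality: nonnegative, and positive exactly where `H` and `G` differ.
  set S : ℝ → ℝ := fun z => deriv u (w - G z) * (G z - H z) - (u (w - H z) - u (w - G z)) with hS
  have hScont : ContinuousOn S (Icc 0 1) :=
    (hdcont.mul (hGc.sub hHc)).sub ((hucont hH).sub (hucont hG))
  have hSpos : ∀ z ∈ Icc (0 : ℝ) 1, H z ≠ G z → 0 < S z := fun z hz hne => by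
    have := hu.sub_lt (hpos hG z hz) (hpos hH z hz) (fun e => hne (by linarith))
    rw [show w - H z - (w - G z) = G z - H z by ring] at this
    simp only [hS]; linarith
  have hSnn : ∀ z ∈ Icc (0 : ℝ) 1, 0 ≤ S z := fun z hz => by
    by_cases e : H z = G z
    · simp [hS, e]
    · exact (hSpos z hz e).le
  have iH := intervalIntegrable_mul_deriv hT (hucont hH) h0 h1
  have iG := intervalIntegrable_mul_deriv hT (hucont hG) h0 h1
  have iGi : IntervalIntegrable G volume 0 1 := hGc.intervalIntegrable_of_Icc zero_le_one
  have iHi : IntervalIntegrable H volume 0 1 := hHc.intervalIntegrable_of_Icc zero_le_one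
  have iD := intervalIntegrable_mul_deriv hT (hdcont.mul (hGc.sub hHc)) h0 h1
  have hSint : ∫ z in (0 : ℝ)..1, S z * deriv T z =
      (∫ z in (0 : ℝ)..1, (deriv u (w - G z) * deriv T z - l) * (G z - H z))
        + l * ((∫ z in (0 : ℝ)..1, G z) - ∫ z in (0 : ℝ)..1, H z)
        - (objective u T w H - objective u T w G) := by
    rw [objective, objective, ← intervalIntegral.integral_sub iGi iHi,
      ← intervalIntegral.integral_const_mul, ← intervalIntegral.integral_sub iH iG,
      ← intervalIntegral.integral_add _ ((iGi.sub iHi).const_mul l),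
      ← intervalIntegral.integral_sub _ (iH.sub iG)]
    · refine intervalIntegral.integral_congr fun z _ => ?_
      simp only [hS]; ring
    · refine iD.congr fun z _ => ?_
      simp only [Pi.mul_apply, Pi.sub_apply]; ring
    · refine (iD.sub ((iGi.sub iHi).const_mul l)).congr fun z _ => ?_
      simp only [Pi.mul_apply, Pi.sub_apply]; ring
  have hnn := integral_mul_deriv_nonneg hT hSnn
  have hl' := mul_nonneg hl (sub_nonneg.2 hGH)
  refine ⟨by linarith, fun heq z hz => ?_⟩
  have hzero : ∫ z in (0 : ℝ)..1, S z * deriv T z = 0 := by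
    refine le_antisymm ?_ hnn
    rw [hSint, heq]; linarith
  by_contra hc
  exact (hSpos z hz hc).ne' (eq_zero_of_integral_mul_deriv_eq_zero hT hScont hSnn hzero z hz)

end Verification

/-! ### Threefold and deductible functions and their means. -/

section Shapes

variable {Q : ℝ → ℝ}

theorem threefold_eq_min (hQ : MonotoneOn Q (Icc 0 1)) {y z t : ℝ} (hy : 0 ≤ y) (hyz : y ≤ z)
    (hz : z ≤ 1) (ht : t ∈ Icc (0 : ℝ) 1) :
    threefold Q y z t = min (max (Q t - Q y) 0) (Q z - Q y) := by
  have hyI : y ∈ Icc (0 : ℝ) 1 := ⟨hy, hyz.trans hz⟩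
  have hzI : z ∈ Icc (0 : ℝ) 1 := ⟨hy.trans hyz, hz⟩
  have h1 := hQ hyI hzI hyz
  unfold threefold
  split_ifs with h2 h3
  · have := hQ ht hyI h2.le
    rw [max_eq_right (by linarith), min_eq_left (by linarith)]
  · have := hQ hyI ht (not_lt.1 h2)
    have := hQ ht hzI h3.le
    rw [max_eq_left (by linarith), min_eq_left (by linarith)]
  · have := hQ hzI ht (not_lt.1 h3)
    rw [max_eq_left (by linarith), min_eq_right (by linarith)]

/-- Reduces deductibles to threefold functions with left kink at `0`. -/
theorem deductible_eq_threefold (hQ : ∀ t ≤ 0, Q t = 0) (f : ℝ) :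
    deductible Q f = threefold Q 0 f := by
  funext t
  unfold deductible threefold
  rw [hQ 0 le_rfl]
  split_ifs with h1 h2 h2
  · exact hQ t h2.le
  · ring
  · rw [hQ f (by linarith)]
  · ring

theorem intervalIntegrable_of_ac (hQ : AbsolutelyContinuousOnInterval Q 0 1) {s t : ℝ}
    (hs : s ∈ Icc (0 : ℝ) 1) (ht : t ∈ Icc (0 : ℝ) 1) : IntervalIntegrable Q volume s t := by
  have h := hQ.continuousOn
  rw [uIcc_of_le zero_le_one] at h
  exact (h.mono (ordConnected_Icc.uIcc_subset hs ht)).intervalIntegrable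

theorem continuousOn_retained (hQ : AbsolutelyContinuousOnInterval Q 0 1) :
    ContinuousOn (retained Q) (Icc 0 1) := by
  have h1 := intervalIntegral.continuousOn_primitive_interval' (μ := volume) (a := 0)
    (intervalIntegrable_of_ac hQ (left_mem_Icc.2 zero_le_one) (right_mem_Icc.2 zero_le_one))
    (by simp)
  have h2 := hQ.continuousOn
  rw [uIcc_of_le zero_le_one] at h1 h2
  exact h1.add (h2.mul (by fun_prop))

theorem le_retained_sub (hQ : AbsolutelyContinuousOnInterval Q 0 1)
    (hm : MonotoneOn Q (Icc 0 1)) {s t : ℝ} (hs : 0 ≤ s) (hst : s ≤ t) (ht : t ≤ 1) :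
    (Q t - Q s) * (1 - t) ≤ retained Q t - retained Q s := by
  have h0 : (0 : ℝ) ∈ Icc (0 : ℝ) 1 := left_mem_Icc.2 zero_le_one
  have hsI : s ∈ Icc (0 : ℝ) 1 := ⟨hs, hst.trans ht⟩
  have htI : t ∈ Icc (0 : ℝ) 1 := ⟨hs.trans hst, ht⟩
  have h1 := intervalIntegral.integral_add_adjacent_intervals
    (intervalIntegrable_of_ac hQ h0 hsI) (intervalIntegrable_of_ac hQ hsI htI)
  have h2 : ∫ _ in s..t, Q s ≤ ∫ x in s..t, Q x :=
    intervalIntegral.integral_mono_on hst intervalIntegrable_const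
      (intervalIntegrable_of_ac hQ hsI htI) fun x hx =>
        hm hsI ⟨hs.trans hx.1, hx.2.trans ht⟩ hx.1
  rw [intervalIntegral.integral_const, smul_eq_mul] at h2
  rw [retained, retained]
  linarith

theorem monotoneOn_retained (hQ : AbsolutelyContinuousOnInterval Q 0 1)
    (hm : MonotoneOn Q (Icc 0 1)) : MonotoneOn (retained Q) (Icc 0 1) := fun s hs t ht hst => by
  have h1 := le_retained_sub hQ hm hs.1 hst ht.2
  have h2 := mul_nonneg (sub_nonneg.2 (hm hs ht hst)) (sub_nonneg.2 ht.2)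
  linarith

/-- `Q` may have flat pieces, so the mean need not determine the kink, but it determines the level
`Q s`. The point `1` is excluded because the factor `1 - t` in `le_retained_sub` degenerates there.
-/
theorem eq_of_retained_eq (hQ : AbsolutelyContinuousOnInterval Q 0 1)
    (hm : MonotoneOn Q (Icc 0 1)) {s t : ℝ} (hs : s ∈ Ico (0 : ℝ) 1) (ht : t ∈ Ico (0 : ℝ) 1)
    (h : retained Q s = retained Q t) : Q s = Q t := by
  wlog hst : s ≤ t generalizing s t
  · exact (this ht hs h.symm (le_of_not_ge hst)).symm
  have h1 := le_retained_sub hQ hm hs.1 hst ht.2.le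
  have h2 := hm (Ico_subset_Icc_self hs) (Ico_subset_Icc_self ht) hst
  have h3 : (Q t - Q s) * (1 - t) ≤ 0 := by linarith
  nlinarith [ht.2]

theorem retained_zero (h0 : Q 0 = 0) : retained Q 0 = 0 := by simp [retained, h0]

theorem continuousOn_threefold (hQ : AbsolutelyContinuousOnInterval Q 0 1)
    (hm : MonotoneOn Q (Icc 0 1)) {y z : ℝ} (hy : 0 ≤ y) (hyz : y ≤ z) (hz : z ≤ 1) :
    ContinuousOn (threefold Q y z) (Icc 0 1) := by
  have h := hQ.continuousOn
  rw [uIcc_of_le zero_le_one] at h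
  refine ContinuousOn.congr ?_ fun t ht => threefold_eq_min hm hy hyz hz ht
  exact ((h.sub continuousOn_const).sup continuousOn_const).inf continuousOn_const

theorem threefold_of_mem_Icc {y z t : ℝ} (ht : t ∈ Icc y z) : threefold Q y z t = Q t - Q y := by
  rcases eq_or_lt_of_le ht.2 with e | hlt
  · simp [threefold, e, not_lt.2 (ht.1.trans ht.2)]
  · simp [threefold, not_lt.2 ht.1, hlt]

theorem threefold_of_le {y z t : ℝ} (hyz : y ≤ z) (ht : z ≤ t) :
    threefold Q y z t = Q z - Q y := by
  simp [threefold, not_lt.2 ht, not_lt.2 (hyz.trans ht)]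

theorem integral_threefold (hQ : AbsolutelyContinuousOnInterval Q 0 1)
    (hm : MonotoneOn Q (Icc 0 1)) {y z : ℝ} (hy : 0 ≤ y) (hyz : y ≤ z) (hz : z ≤ 1) :
    ∫ t in (0 : ℝ)..1, threefold Q y z t = retained Q z - retained Q y := by
  have h0 : (0 : ℝ) ∈ Icc (0 : ℝ) 1 := left_mem_Icc.2 zero_le_one
  have hyI : y ∈ Icc (0 : ℝ) 1 := ⟨hy, hyz.trans hz⟩
  have hzI : z ∈ Icc (0 : ℝ) 1 := ⟨hy.trans hyz, hz⟩
  have e1 : EqOn (threefold Q y z) (fun _ => 0) (Ioo 0 y) := fun t ht => by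
    simp [threefold, ht.2]
  have e2 : EqOn (threefold Q y z) (fun t => Q t - Q y) (Ioo y z) := fun t ht =>
    threefold_of_mem_Icc (Ioo_subset_Icc_self ht)
  have e3 : EqOn (threefold Q y z) (fun _ => Q z - Q y) (Ioo z 1) := fun t ht =>
    threefold_of_le hyz ht.1.le
  have j : ∀ {s t : ℝ}, s ∈ Icc (0 : ℝ) 1 → t ∈ Icc (0 : ℝ) 1 →
      IntervalIntegrable (threefold Q y z) volume s t := fun hs ht =>
    ((continuousOn_threefold hQ hm hy hyz hz).mono
      (ordConnected_Icc.uIcc_subset hs ht)).intervalIntegrable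
  rw [← intervalIntegral.integral_add_adjacent_intervals (j h0 hzI)
      (j hzI (right_mem_Icc.2 zero_le_one)),
    ← intervalIntegral.integral_add_adjacent_intervals (j h0 hyI) (j hyI hzI),
    intervalIntegral.integral_congr_Ioo_of_le hy e1,
    intervalIntegral.integral_congr_Ioo_of_le hyz e2,
    intervalIntegral.integral_congr_Ioo_of_le hz e3,
    intervalIntegral.integral_sub (intervalIntegrable_of_ac hQ hyI hzI) intervalIntegrable_const]
  have h1 := intervalIntegral.integral_add_adjacent_intervals
    (intervalIntegrable_of_ac hQ h0 hyI) (intervalIntegrable_of_ac hQ hyI hzI)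
  simp only [intervalIntegral.integral_const, smul_eq_mul, retained]
  rw [← h1]
  ring

end Shapes

/-! ### First-order condition and existence for threefold functions. -/

namespace IsRegular

variable {v T Q : ℝ → ℝ} {W M a c : ℝ} (h : IsRegular v T Q W M a c)

include h

/-- First-order sign condition for the threefold function of `(y, z)`. -/
theorem sign_condition {w y z : ℝ} (hw : W ≤ w) (hwa : 0 < w - Q a) (hy : y ∈ Icc 0 a)
    (hz : z ∈ Ico a 1) (hk : 0 ≤ kFun v T Q (w + Q y) y z)
    (hy0 : y = 0 ∨ kFun v T Q (w + Q y) y z = 0) {H : ℝ → ℝ} (hH : IsRetentionOf Q H) :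
    ∀ᵐ x, x ∈ Ioo (0 : ℝ) 1 → DifferentiableAt ℝ Q x → DifferentiableAt ℝ H x →
      0 ≤ (∫ s in (1 : ℝ)..x, (v (w - threefold Q y z s) * deriv T s
          - v (w + Q y - Q z) * ratio T z)) * (deriv (threefold Q y z) x - deriv H x) := by
  have h0 : (0 : ℝ) ∈ Icc (0 : ℝ) 1 := left_mem_Icc.2 zero_le_one
  have h1 : (1 : ℝ) ∈ Icc (0 : ℝ) 1 := right_mem_Icc.2 zero_le_one
  have hyI : y ∈ Icc (0 : ℝ) 1 := ⟨hy.1, hy.2.trans h.a_mem.2⟩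
  have hzI : z ∈ Icc (0 : ℝ) 1 := ⟨h.a_mem.1.trans hz.1, hz.2.le⟩
  have hyz : y ≤ z := hy.2.trans hz.1
  have hQy := h.nonneg hyI
  have hw' : W ≤ w + Q y := by linarith
  have hwa' : 0 < w + Q y - Q a := by linarith
  set V := v (w + Q y - Q z) with hV
  -- The multiplier for which the primitive `N` based at `1` vanishes at `z`.
  set l := V * ratio T z with hl
  set p : ℝ → ℝ := fun s => v (w - threefold Q y z s) * deriv T s - l with hp
  have hG := continuousOn_threefold h.ac h.mono hy.1 hyz hzI.2
  have ip : ∀ {s t : ℝ}, s ∈ Icc (0 : ℝ) 1 → t ∈ Icc (0 : ℝ) 1 →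
      IntervalIntegrable p volume s t := fun hs ht =>
    (intervalIntegrable_mul_deriv h.inverseS
      (h.cont_v.comp_continuousOn (continuousOn_const.sub hG)) hs ht).sub intervalIntegrable_const
  -- beyond `z`
  have hN3 : ∀ x ∈ Icc z 1, ∫ s in (1 : ℝ)..x, p s = l * (1 - x) - V * (1 - T x) := fun x hx => by
    have hxI : x ∈ Icc (0 : ℝ) 1 := ⟨hzI.1.trans hx.1, hx.2⟩
    have e : ∫ s in x..1, p s = ∫ s in x..1, (V * deriv T s - l) := by
      refine intervalIntegral.integral_congr fun s hs => ?_
      rw [uIcc_of_le hx.2] at hs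
      simp only [hp, threefold_of_le hyz (hx.1.trans hs.1), hV]
      congr 3; ring
    rw [intervalIntegral.integral_symm, e, intervalIntegral.integral_sub
      ((h.inverseS.intervalIntegrable_deriv hxI h1).const_mul V) intervalIntegrable_const,
      intervalIntegral.integral_const_mul, h.inverseS.integral_deriv hxI h1 hx.2,
      intervalIntegral.integral_const, smul_eq_mul, h.inverseS.map_one]
    ring
  have hNz : ∫ s in (1 : ℝ)..z, p s = 0 := by
    rw [hN3 z ⟨le_rfl, hz.2.le⟩, hl, mul_assoc, ratio_mul hz.2, sub_self]
  -- between `y` and `z`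
  have hN2 : ∀ x ∈ Icc y z, ∫ s in (1 : ℝ)..x, p s = kFun v T Q (w + Q y) x z := fun x hx => by
    have hxI : x ∈ Icc (0 : ℝ) 1 := ⟨hy.1.trans hx.1, hx.2.trans hzI.2⟩
    have e : ∫ s in x..z, p s = ∫ s in x..z, (v (w + Q y - Q s) * deriv T s - l) := by
      refine intervalIntegral.integral_congr fun s hs => ?_
      rw [uIcc_of_le hx.2] at hs
      simp only [hp, threefold_of_mem_Icc ⟨hx.1.trans hs.1, hs.2⟩]
      congr 3; ring
    rw [← intervalIntegral.integral_add_adjacent_intervals (ip h1 hzI) (ip hzI hxI), hNz, zero_add,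
      intervalIntegral.integral_symm, e, intervalIntegral.integral_sub
      (h.intervalIntegrable _ hxI hzI) intervalIntegrable_const,
      intervalIntegral.integral_const, smul_eq_mul, kFun, ← hV, ← hl]
    ring
  filter_upwards [(Set.toFinite ({y, z} : Set ℝ)).countable.ae_notMem volume] with x hxn hx hQd hHd
  simp only [mem_insert_iff, mem_singleton_iff, not_or] at hxn
  have hd := hH.deriv_mem hx hQd hHd
  rcases lt_or_gt_of_ne hxn.1 with hxy | hxy
  · have hG' : deriv (threefold Q y z) x = 0 := by
      have : threefold Q y z =ᶠ[𝓝 x] fun _ => 0 := by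
        filter_upwards [Iio_mem_nhds hxy] with t ht
        simp [threefold, mem_Iio.1 ht]
      rw [this.deriv_eq, deriv_const]
    -- This zone exists only if `y > 0`, and then `k = 0`, so `N(y) = 0`. By `multiplier_le` and the
    -- decrease of `T'`, the integrand is nonnegative before `y`, so `N ≤ 0` there.
    have hypos : 0 < y := hx.1.trans hxy
    have hk0 := hy0.resolve_left hypos.ne'
    have hml := h.multiplier_le hw' hwa' ⟨hypos, hy.2⟩ hz hk0
    rw [add_sub_cancel_right, ← hV, ← hl] at hml
    have hxI := Ioo_subset_Icc_self hx
    have hnn : 0 ≤ ∫ s in x..y, p s := by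
      rw [← intervalIntegral.integral_zero (a := x) (b := y)]
      refine intervalIntegral.integral_mono_on_of_le_Ioo hxy.le intervalIntegrable_const
        (ip hxI hyI) fun s hs => ?_
      have hT := h.deriv_anti.antitoneOn (a := s) (b := y) ⟨hx.1.trans hs.1, hs.2.le.trans hy.2⟩
        ⟨hypos, hy.2⟩ hs.2.le
      have := mul_le_mul_of_nonneg_left hT (h.pos_v w).le
      simp only [hp]
      rw [show threefold Q y z s = 0 by simp [threefold, hs.2], sub_zero]
      linarith
    have hN : ∫ s in (1 : ℝ)..x, p s ≤ 0 := by
      rw [← intervalIntegral.integral_add_adjacent_intervals (ip h1 hyI) (ip hyI hxI),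
        hN2 y ⟨le_rfl, hyz⟩, hk0, intervalIntegral.integral_symm x y]
      linarith
    exact mul_nonneg_of_nonpos_of_nonpos hN (by rw [hG']; linarith)
  rcases lt_or_gt_of_ne hxn.2 with hxz | hxz
  · have hG' : deriv (threefold Q y z) x = deriv Q x := by
      have : threefold Q y z =ᶠ[𝓝 x] fun t => Q t - Q y := by
        filter_upwards [Ioo_mem_nhds hxy hxz] with t ht
        exact threefold_of_mem_Icc (Ioo_subset_Icc_self ht)
      rw [this.deriv_eq, deriv_sub_const]
    rw [hN2 x ⟨hxy.le, hxz.le⟩, hG']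
    exact mul_nonneg (h.kFun_nonneg_of_nonneg hw' hwa' hy hz hk ⟨hxy.le, hxz.le⟩) (by linarith)
  · have hG' : deriv (threefold Q y z) x = 0 := by
      have : threefold Q y z =ᶠ[𝓝 x] fun _ => Q z - Q y := by
        filter_upwards [Ioi_mem_nhds hxz] with t ht
        exact threefold_of_le hyz (mem_Ioi.1 ht).le
      rw [this.deriv_eq, deriv_const]
    -- Beyond `z` one has `N(x) = V * (1 - x) * (ratio T z - ratio T x)`, and `ratio T` increases
    -- there.
    have hN : ∫ s in (1 : ℝ)..x, p s ≤ 0 := by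
      rw [hN3 x ⟨hxz.le, hx.2.le⟩, ← ratio_mul hx.2, hl]
      have hr := h.turning.2.2 hz ⟨hz.1.trans hxz.le, hx.2⟩ hxz
      have := mul_nonneg (h.pos_v (w + Q y - Q z)).le
        (mul_nonneg (sub_nonneg.2 hr.le) (sub_nonneg.2 hx.2.le))
      rw [← hV] at this
      nlinarith
    exact mul_nonneg_of_nonpos_of_nonpos hN (by rw [hG']; linarith)

/-- Existence of an admissible pair. -/
theorem exists_pair {w Δ : ℝ} (hw : W ≤ w) (hwa : 0 < w - Q a) (hΔ : 0 ≤ Δ) {l : ℝ}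
    (hl : l ∈ Ico a 1) (hl0 : kFun v T Q w 0 l ≤ 0) (hΔl : Δ ≤ retained Q l) :
    ∃ y ∈ Icc 0 a, ∃ z ∈ Icc a c, kFun v T Q (w + Q y) y z = 0 ∧
      retained Q z - retained Q y = Δ := by
  have hsub : Icc 0 a ⊆ Icc (0 : ℝ) 1 := Icc_subset_Icc_right h.a_mem.2
  have hex : ∀ y ∈ Icc 0 a, ∃ z ∈ Icc a c, kFun v T Q (w + Q y) y z = 0 := fun y hy =>
    h.exists_kFun_eq_zero (by linarith [h.nonneg (hsub hy)])
      (by linarith [h.nonneg (hsub hy)]) hy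
  choose! ζ hζ hζ0 using hex
  have hIco : ∀ {z}, z ∈ Icc a c → z ∈ Ico a 1 := fun hz => ⟨hz.1, hz.2.trans_lt h.unit.1.2⟩
  -- Strict monotonicity in `z` turns `b < ζ y'` and `ζ y' < b` into signs of `k` at the fixed point
  -- `b`, which are open conditions in `y'`.
  have hcont : ContinuousOn ζ (Icc 0 a) := by
    intro y hy
    have hmono := fun y' (hy' : y' ∈ Icc 0 a) => h.kFun_strictMonoOn (w + Q y') hy'
    refine tendsto_order.2 ⟨fun b hb => ?_, fun b hb => ?_⟩
    · rcases lt_or_ge b a with hba | hab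
      · filter_upwards [self_mem_nhdsWithin] with y' hy'
        exact hba.trans_le (hζ y' hy').1
      · have hbI : b ∈ Ico a 1 := ⟨hab, hb.trans (hIco (hζ y hy)).2⟩
        have hneg : kFun v T Q (w + Q y) y b < 0 := by
          rw [← hζ0 y hy]; exact hmono y hy hbI (hIco (hζ y hy)) hb
        filter_upwards [(h.continuousOn_kFun_left w hbI y hy).eventually (gt_mem_nhds hneg),
          self_mem_nhdsWithin] with y' h1 hy'
        rw [← hζ0 y' hy'] at h1
        exact (hmono y' hy').lt_iff_lt hbI (hIco (hζ y' hy')) |>.1 h1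
    · rcases le_or_gt 1 b with h1b | hb1
      · filter_upwards [self_mem_nhdsWithin] with y' hy'
        exact (hIco (hζ y' hy')).2.trans_le h1b
      · have hbI : b ∈ Ico a 1 := ⟨(hζ y hy).1.trans hb.le, hb1⟩
        have hpos : 0 < kFun v T Q (w + Q y) y b := by
          rw [← hζ0 y hy]; exact hmono y hy (hIco (hζ y hy)) hbI hb
        filter_upwards [(h.continuousOn_kFun_left w hbI y hy).eventually (lt_mem_nhds hpos),
          self_mem_nhdsWithin] with y' h1 hy'
        rw [← hζ0 y' hy'] at h1
        exact (hmono y' hy').lt_iff_lt (hIco (hζ y' hy')) hbI |>.1 h1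
  have hmap : MapsTo ζ (Icc 0 a) (Icc (0 : ℝ) 1) := fun y hy =>
    ⟨h.a_mem.1.trans (hζ y hy).1, (hIco (hζ y hy)).2.le⟩
  have hI : ContinuousOn (fun y => retained Q (ζ y) - retained Q y) (Icc 0 a) :=
    ((continuousOn_retained h.ac).comp hcont hmap).sub ((continuousOn_retained h.ac).mono hsub)
  have h0m : (0 : ℝ) ∈ Icc 0 a := ⟨le_rfl, h.a_mem.1⟩
  have ham : a ∈ Icc 0 a := ⟨h.a_mem.1, le_rfl⟩
  have hζa : ζ a = a := by
    refine (h.kFun_strictMonoOn (w + Q a) ham).injOn (hIco (hζ a ham)) ⟨le_rfl, h.turning.1.2⟩ ?_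
    rw [hζ0 a ham]; simp [kFun]
  have hζl : l ≤ ζ 0 := by
    refine (h.kFun_strictMonoOn w h0m).le_iff_le hl (hIco (hζ 0 h0m)) |>.1 ?_
    have := hζ0 0 h0m
    rw [h.zero, add_zero] at this
    rwa [this]
  have hend : Δ ≤ retained Q (ζ 0) - retained Q 0 := by
    rw [retained_zero h.zero, sub_zero]
    exact hΔl.trans (monotoneOn_retained h.ac h.mono ⟨h.a_mem.1.trans hl.1, hl.2.le⟩
      (hmap h0m) hζl)
  obtain ⟨y, hy, e⟩ := intermediate_value_Icc' h.a_mem.1 hI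
    (show Δ ∈ Icc _ _ from ⟨by simpa [hζa] using hΔ, hend⟩)
  exact ⟨y, hy, ζ y, hζ y hy, hζ0 y hy, e⟩

end IsRegular

/-! ### Optimality of the candidate solutions. -/

section Problem

variable {Ω : Type*} [MeasurableSpace Ω] {P : Measure Ω}
  {X : Ω → ℝ} {M W a c : ℝ} {u T : ℝ → ℝ}

theorem integral_eq_kFun (h : IsRegular (marginalFrom u (W - M)) T (quantile P X) W M a c)
    {w y z : ℝ} (hw : W ≤ w) (hy : 0 ≤ y) (hyz : y ≤ z) (hz : z ≤ 1) :
    ∫ t in y..z, (marginal u (w - quantile P X z) * (1 - T z) / (1 - z)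
      - marginal u (w - quantile P X t) * deriv T t)
      = kFun (marginalFrom u (W - M)) T (quantile P X) w y z := by
  have hyI : y ∈ Icc (0 : ℝ) 1 := ⟨hy, hyz.trans hz⟩
  have hzI : z ∈ Icc (0 : ℝ) 1 := ⟨hy.trans hyz, hz⟩
  have e : ∀ t ∈ Icc (0 : ℝ) 1,
      marginal u (w - quantile P X t) = marginalFrom u (W - M) (w - quantile P X t) :=
    fun t ht => (marginalFrom_of_le u (by linarith [h.le_M t ht])).symm
  have : ∫ t in y..z, (marginal u (w - quantile P X z) * (1 - T z) / (1 - z)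
      - marginal u (w - quantile P X t) * deriv T t) =
      ∫ t in y..z, (marginalFrom u (W - M) (w - quantile P X z) * ratio T z
      - marginalFrom u (W - M) (w - quantile P X t) * deriv T t) := by
    refine intervalIntegral.integral_congr fun t ht => ?_
    rw [uIcc_of_le hyz] at ht
    simp only [e z hzI, e t ⟨hy.trans ht.1, ht.2.trans hz⟩, ratio, mul_div_assoc]
  rw [this, intervalIntegral.integral_sub intervalIntegrable_const (h.intervalIntegrable w hyI hzI),
    intervalIntegral.integral_const, smul_eq_mul, kFun]

theorem exists_isTheOnly_isZeroOfH
    (h : IsRegular (marginalFrom u (W - M)) T (quantile P X) W M a c) {w : ℝ} (hw : W ≤ w)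
    (hwa : 0 < w - quantile P X a) :
    ∃ l ∈ Icc a c, kFun (marginalFrom u (W - M)) T (quantile P X) w 0 l = 0 ∧
      IsTheOnly (IsZeroOfH u T (quantile P X) w a c) l := by
  have h0 : (0 : ℝ) ∈ Icc 0 a := ⟨le_rfl, h.a_mem.1⟩
  have hIco : ∀ {z}, z ∈ Icc a c → z ∈ Ico a 1 := fun hz => ⟨hz.1, hz.2.trans_lt h.unit.1.2⟩
  have he : ∀ z ∈ Icc a c, hFun u T (quantile P X) w z =
      kFun (marginalFrom u (W - M)) T (quantile P X) w 0 z := fun z hz =>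
    integral_eq_kFun h hw le_rfl (h.a_mem.1.trans hz.1) (hIco hz).2.le
  obtain ⟨l, hl, hl0⟩ := h.exists_kFun_eq_zero hw hwa h0
  refine ⟨l, hl, hl0, ⟨hl, (he l hl).trans hl0⟩, fun y hy => ?_⟩
  refine (h.kFun_strictMonoOn w h0).injOn (hIco hy.1) (hIco hl) ?_
  rw [hl0, ← he y hy.1, hy.2]

variable [IsProbabilityMeasure P]

theorem isRetentionOf_of_mem (hM : 0 < M) (hX : IsLoss P X M) {H : ℝ → ℝ}
    (hH : H ∈ quantileSet P X M) : IsRetentionOf (quantile P X) H := by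
  obtain ⟨R, hR, hHR⟩ := hH
  have e : ∀ t ∈ Icc (0 : ℝ) 1, H t = R (quantile P X t) := fun t ht => by
    rw [hHR t ht, quantile_comp hM hX hR ht]
  refine ⟨?_, fun s t hs hst ht => ?_⟩
  · rw [e 0 (left_mem_Icc.2 zero_le_one), quantile_of_nonpos le_rfl, hR.1]
  · have hsI : s ∈ Icc (0 : ℝ) 1 := ⟨hs, hst.trans ht⟩
    have htI : t ∈ Icc (0 : ℝ) 1 := ⟨hs.trans hst, ht⟩
    rw [e s hsI, e t htI]
    exact hR.2 _ _ (quantile_nonneg s) (monotoneOn_quantile hM hX hsI htI hst)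
      (quantile_le hM hX ht)

theorem threefold_mem_quantileSet (hM : 0 < M) (hX : IsLoss P X M) {y z : ℝ} (hy : 0 ≤ y)
    (hyz : y ≤ z) (hz : z ≤ 1) : threefold (quantile P X) y z ∈ quantileSet P X M := by
  set Q := quantile P X
  have hQ := monotoneOn_quantile hM hX (P := P)
  have hle : Q y ≤ Q z := hQ ⟨hy, hyz.trans hz⟩ ⟨hy.trans hyz, hz⟩ hyz
  have hR : (fun x => min (max (x - Q y) 0) (Q z - Q y)) ∈ retentions M := by
    refine ⟨?_, fun s t _ hts _ => ?_⟩
    · have h0 : 0 ≤ Q y := quantile_nonneg y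
      simp only
      rw [max_eq_right (by linarith), min_eq_left (by linarith)]
    · simp only
      constructor
      · have := min_le_min_right (Q z - Q y) (max_le_max_right 0 (sub_le_sub_right hts (Q y)))
        linarith
      · rw [sub_le_iff_le_add, ← min_add_add_left]
        refine min_le_min ?_ (by linarith)
        rw [← max_add_add_left]
        exact max_le_max (by linarith) (by linarith)
  refine ⟨_, hR, fun t ht => ?_⟩
  rw [quantile_comp hM hX hR ht, threefold_eq_min hQ hy hyz hz ht]

/-- Without a binding constraint, zero retention is pointwise best because `u` increases. No
marginal utility is used, since with `w = W = M` wealth may reach `0` and `objective_le` is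
unavailable. -/
theorem isOptimal_zero (hM : 0 < M) (hX : IsLoss P X M) (hWM : 0 ≤ W - M) (hT : IsInverseS T)
    (hu : IsStrictlyConcaveUtility u) (hu0 : W - M = 0 → DifferentiableWithinAt ℝ u (Ici 0) 0) :
    IsOptimal P X M 0 W u T (fun _ => 0) := by
  have hmem : (fun _ => 0) ∈ quantileSet P X M := by
    have hR : (fun _ => 0 : ℝ → ℝ) ∈ retentions M := ⟨rfl, fun s t _ hts _ => by simpa using hts⟩
    exact ⟨_, hR, fun t ht => (quantile_comp hM hX hR ht).symm⟩
  have hucont : ContinuousOn u (Ici (W - M)) := fun x hx => by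
    rcases eq_or_lt_of_le (hWM.trans hx) with e | hpos
    · have hx : W - M ≤ x := hx
      have e' : W - M = 0 := by linarith
      rw [← e, e']
      exact (hu0 e').continuousWithinAt
    · exact (hu.differentiable x hpos).continuousAt.continuousWithinAt
  have key : ∀ H ∈ feasible P X M 0, objective u T W H ≤ objective u T W (fun _ => 0) ∧
      (objective u T W H = objective u T W (fun _ => 0) → ∀ z ∈ Icc (0 : ℝ) 1, H z = 0) := by
    intro H hH
    have hR := isRetentionOf_of_mem hM hX hH.1
    have hHM : ∀ z ∈ Icc (0 : ℝ) 1, W - M ≤ W - H z := fun z hz => by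
      linarith [hR.le (quantile_of_nonpos le_rfl) hz, quantile_le (P := P) hM hX hz.2]
    have hHc : ContinuousOn (fun z => u (W - H z)) (Icc 0 1) :=
      hucont.comp (continuousOn_const.sub (hR.continuousOn hX.quantile_ac)) hHM
    have hlt : ∀ z ∈ Icc (0 : ℝ) 1, H z ≠ 0 → u (W - H z) < u (W - 0) := fun z hz hne => by
      have := lt_of_le_of_ne (hR.nonneg hz) hne.symm
      exact hu.strictMono (mem_Ici.2 (hWM.trans (hHM z hz))) (mem_Ici.2 (by linarith))
        (by linarith)
    have hS : ∀ z ∈ Icc (0 : ℝ) 1, 0 ≤ u (W - 0) - u (W - H z) := fun z hz => by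
      by_cases e : H z = 0
      · rw [e, sub_self]
      · exact (sub_pos.2 (hlt z hz e)).le
    have hint : ∫ z in (0 : ℝ)..1, (u (W - 0) - u (W - H z)) * deriv T z =
        objective u T W (fun _ => 0) - objective u T W H := by
      have h0 := left_mem_Icc.2 (zero_le_one' ℝ)
      have h1 := right_mem_Icc.2 (zero_le_one' ℝ)
      rw [objective, objective, ← intervalIntegral.integral_sub
        (intervalIntegrable_mul_deriv hT continuousOn_const h0 h1)
        (intervalIntegrable_mul_deriv hT hHc h0 h1)]
      exact intervalIntegral.integral_congr fun z _ => sub_mul _ _ _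
    have hnn := integral_mul_deriv_nonneg hT hS
    refine ⟨by linarith, fun heq z hz => ?_⟩
    by_contra hc
    exact (sub_pos.2 (hlt z hz hc)).ne' (eq_zero_of_integral_mul_deriv_eq_zero hT
      (continuousOn_const.sub hHc) hS (hint.trans (by rw [heq, sub_self])) z hz)
  exact ⟨⟨hmem, by simp⟩, fun H hH => (key H hH).1, fun H hH => (key H hH).2⟩

/-- Full retention is the pointwise largest candidate, so requiring its mean leaves no other
feasible function. This covers the kink at `1`, where `ratio T` degenerates. -/
theorem isOptimal_quantile (hM : 0 < M) (hX : IsLoss P X M) (w : ℝ) :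
    IsOptimal P X M (∫ z in (0 : ℝ)..1, deductible (quantile P X) 1 z) w u T
      (deductible (quantile P X) 1) := by
  have hmem : deductible (quantile P X) 1 ∈ quantileSet P X M := by
    rw [deductible_eq_threefold (fun t ht => quantile_of_nonpos ht)]
    exact threefold_mem_quantileSet hM hX le_rfl zero_le_one le_rfl
  have hD := isRetentionOf_of_mem hM hX hmem
  have hkey : ∀ H ∈ feasible P X M (∫ z in (0 : ℝ)..1, deductible (quantile P X) 1 z),
      ∀ z ∈ Icc (0 : ℝ) 1, H z = deductible (quantile P X) 1 z := by
    intro H hH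
    have hR := isRetentionOf_of_mem hM hX hH.1
    have hle : ∀ z ∈ Icc (0 : ℝ) 1, H z ≤ deductible (quantile P X) 1 z := fun z hz => by
      have := hR.le (quantile_of_nonpos le_rfl) hz
      unfold deductible
      split_ifs with h1
      · exact this
      · rwa [le_antisymm hz.2 (not_lt.1 h1)] at this ⊢
    by_contra! hne
    obtain ⟨z, hz, hzne⟩ := hne
    have := intervalIntegral.integral_lt_integral_of_continuousOn_of_le_of_exists_lt zero_lt_one
      (hR.continuousOn hX.quantile_ac) (hD.continuousOn hX.quantile_ac)
      (fun x hx => hle x (Ioc_subset_Icc_self hx)) ⟨z, hz, lt_of_le_of_ne (hle z hz) hzne⟩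
    exact absurd hH.2 (not_le.2 this)
  refine ⟨⟨hmem, le_rfl⟩, fun H hH => le_of_eq ?_, fun H hH _ => hkey H hH⟩
  unfold objective
  refine intervalIntegral.integral_congr fun z hz => ?_
  rw [uIcc_of_le zero_le_one] at hz
  simp only [hkey H hH z hz]

theorem isOptimal_threefold (hM : 0 < M) (hX : IsLoss P X M) (hWM : 0 ≤ W - M)
    (hu : IsStrictlyConcaveUtility u)
    (h : IsRegular (marginalFrom u (W - M)) T (quantile P X) W M a c) {w Δ y z : ℝ} (hw : W < w)
    (hy : y ∈ Icc 0 a) (hz : z ∈ Ico a 1)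
    (hk : 0 ≤ kFun (marginalFrom u (W - M)) T (quantile P X) (w + quantile P X y) y z)
    (hy0 : y = 0 ∨ kFun (marginalFrom u (W - M)) T (quantile P X) (w + quantile P X y) y z = 0)
    (hΔ : ∫ t in (0 : ℝ)..1, threefold (quantile P X) y z t = Δ) :
    IsOptimal P X M Δ w u T (threefold (quantile P X) y z) := by
  have hmem := threefold_mem_quantileSet (P := P) hM hX hy.1 (hy.2.trans hz.1) hz.2.le
  have hG := isRetentionOf_of_mem hM hX hmem
  have hwa : 0 < w - quantile P X a := by linarith [h.le_M a h.a_mem]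
  have key : ∀ H ∈ feasible P X M Δ,
      objective u T w H ≤ objective u T w (threefold (quantile P X) y z) ∧
      (objective u T w H = objective u T w (threefold (quantile P X) y z) →
        ∀ t ∈ Icc (0 : ℝ) 1, H t = threefold (quantile P X) y z t) := fun H hH => by
    have hR := isRetentionOf_of_mem hM hX hH.1
    have hsign := h.sign_condition hw.le hwa hy hz hk hy0 hR
    have hnonpos := integral_mul_sub_nonpos hX.quantile_ac hG hR
      ((intervalIntegrable_mul_deriv h.inverseS (h.cont_v.comp_continuousOn
        (continuousOn_const.sub (hG.continuousOn hX.quantile_ac)))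
        (left_mem_Icc.2 zero_le_one) (right_mem_Icc.2 zero_le_one)).sub
        intervalIntegrable_const) hsign
    refine objective_le (l := marginalFrom u (W - M) (w + quantile P X y - quantile P X z)
      * ratio T z) hu h.inverseS hX.quantile_ac h.zero h.le_M (by linarith) hG hR
      (mul_pos (h.pos_v _) (ratio_pos h.inverseS (h.a_mem.1.trans hz.1) hz.2)).le
      (hΔ.trans_le hH.2) (le_of_eq_of_le ?_ hnonpos)
    refine intervalIntegral.integral_congr fun t ht => ?_
    rw [uIcc_of_le zero_le_one] at ht
    have hpos : W - M < w - threefold (quantile P X) y z t := by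
      linarith [hG.le h.zero ht, h.le_M t ht]
    simp only [Function.comp, Pi.sub_apply]
    rw [marginalFrom_of_le u hpos.le, marginal_of_pos u (hWM.trans_lt hpos)]
  exact ⟨⟨hmem, hΔ.ge⟩, fun H hH => (key H hH).1, fun H hH => (key H hH).2⟩

theorem isOptimal_deductible (hM : 0 < M) (hX : IsLoss P X M) (hWM : 0 ≤ W - M)
    (hu : IsStrictlyConcaveUtility u)
    (h : IsRegular (marginalFrom u (W - M)) T (quantile P X) W M a c) {w Δ f : ℝ} (hw : W < w)
    (hf : f ∈ Ico a 1) (hk : 0 ≤ kFun (marginalFrom u (W - M)) T (quantile P X) w 0 f)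
    (hΔ : ∫ t in (0 : ℝ)..1, deductible (quantile P X) f t = Δ) :
    IsOptimal P X M Δ w u T (deductible (quantile P X) f) := by
  rw [deductible_eq_threefold fun t ht => quantile_of_nonpos ht] at hΔ ⊢
  refine isOptimal_threefold hM hX hWM hu h hw ⟨le_rfl, h.a_mem.1⟩ hf ?_ (Or.inl rfl) hΔ
  rwa [h.zero, add_zero]

theorem integral_deductible (hM : 0 < M) (hX : IsLoss P X M) {f : ℝ} (hf : f ∈ Icc (0 : ℝ) 1) :
    ∫ t in (0 : ℝ)..1, deductible (quantile P X) f t = retained (quantile P X) f := by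
  rw [deductible_eq_threefold fun t ht => quantile_of_nonpos ht,
    integral_threefold hX.quantile_ac (monotoneOn_quantile hM hX) le_rfl hf.1 hf.2,
    retained_zero (quantile_of_nonpos le_rfl), sub_zero]

theorem deductible_congr (hM : 0 < M) (hX : IsLoss P X M) {f g : ℝ} (hf : f ∈ Icc (0 : ℝ) 1)
    (hg : g ∈ Icc (0 : ℝ) 1) (hfg : quantile P X f = quantile P X g) :
    deductible (quantile P X) f = deductible (quantile P X) g := by
  wlog hle : f ≤ g generalizing f g
  · exact (this hg hf hfg.symm (le_of_not_ge hle)).symm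
  have hQ := monotoneOn_quantile (P := P) hM hX
  funext t
  unfold deductible
  split_ifs with h1 h2 h2
  · rfl
  · linarith
  · have hft := not_lt.1 h1
    have htI : t ∈ Icc (0 : ℝ) 1 := ⟨hf.1.trans hft, h2.le.trans hg.2⟩
    exact le_antisymm (hQ hf htI hft) (hfg ▸ hQ htI hg h2.le)
  · exact hfg

/-- The point `l` certifies that the deductible at the zero of `k` for `y = 0` retains at least `Δ`,
which starts the intermediate value argument of `exists_pair`. -/
theorem threefoldOptimal (hM : 0 < M) (hX : IsLoss P X M) (hWM : 0 ≤ W - M)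
    (hu : IsStrictlyConcaveUtility u)
    (h : IsRegular (marginalFrom u (W - M)) T (quantile P X) W M a c) {w Δ l : ℝ} (hw : W < w)
    (hΔ : 0 ≤ Δ) (hl : l ∈ Ico a 1)
    (hl0 : kFun (marginalFrom u (W - M)) T (quantile P X) w 0 l ≤ 0)
    (hΔl : Δ ≤ retained (quantile P X) l) : ThreefoldOptimal P X M Δ w a u T := by
  have hiff : ∀ y z, 0 ≤ y → y ≤ z → z ≤ 1 →
      ∫ t in y..z, (marginal u (w - quantile P X z + quantile P X y) * (1 - T z) / (1 - z)
        - marginal u (w - quantile P X t + quantile P X y) * deriv T t)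
      = kFun (marginalFrom u (W - M)) T (quantile P X) (w + quantile P X y) y z := by
    intro y z hy hyz hz
    simp_rw [sub_add_eq_add_sub]
    exact integral_eq_kFun h (by linarith [quantile_nonneg (P := P) (X := X) y]) hy hyz hz
  constructor
  · obtain ⟨y, hy, z, hz, hk, e⟩ := h.exists_pair hw.le
      (by linarith [h.le_M a h.a_mem]) hΔ hl hl0 hΔl
    have hz1 := hz.2.trans_lt h.unit.1.2
    have hyz := hy.2.trans hz.1
    refine ⟨y, z, hy.1, hy.2, hz.1, hz1, ?_, ?_⟩
    · rw [hiff y z hy.1 hyz hz1.le, hk]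
    · rw [integral_threefold h.ac h.mono hy.1 hyz hz1.le, e]
  · rintro y z ⟨hy0, hya, haz, hz1, hk, e⟩
    rw [hiff y z hy0 (hya.trans haz) hz1.le] at hk
    exact isOptimal_threefold hM hX hWM hu h hw ⟨hy0, hya⟩ ⟨haz, hz1⟩ hk.ge (Or.inr hk) e

theorem isRegular_marginalFrom (hM : 0 < M) (hX : IsLoss P X M) (hWM : 0 ≤ W - M)
    (hT : IsInverseS T) (hu : IsStrictlyConcaveUtility u)
    (hu0 : W - M = 0 → DifferentiableWithinAt ℝ u (Ici 0) 0)
    (hAu : StrictAntiOn (arrowPratt u) (Ioi 0)) (ha : IsTurningPoint T a)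
    (hanti : StrictAntiOn (deriv T) (Ioc 0 a)) (hda : deriv T a = ratio T a)
    (hc : IsUnitPoint T a c)
    (hAT : ∀ z ∈ Ioc 0 a, DifferentiableAt ℝ (quantile P X) z →
      arrowPratt u (W - quantile P X z) * deriv (quantile P X) z < arrowPratt T z) :
    IsRegular (marginalFrom u (W - M)) T (quantile P X) W M a c where
  inverseS := hT
  turning := ha
  deriv_anti := hanti
  deriv_turning := hda
  unit := hc
  ac := hX.quantile_ac
  mono := monotoneOn_quantile hM hX
  zero := quantile_of_nonpos le_rfl
  le_M := fun _ ht => quantile_le hM hX ht.2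
  cont_v := continuous_marginalFrom hu hWM hu0
  anti_v := antitone_marginalFrom hu hWM hu0
  pos_v := marginalFrom_pos hu hWM hu0
  anti_mul := fun w hw hwa => by
    have hQm := monotoneOn_quantile (P := P) hM hX
    refine (strictAntiOn_deriv_mul_deriv hu hAu hT ha.1 hanti
      (hda ▸ ratio_pos hT ha.1.1.le ha.1.2) hX.quantile_ac hQm
      (fun _ ht => quantile_le hM hX ht.2) hWM hAT hw hwa).congr fun t ht => ?_
    have h1 := hQm ⟨ht.1.le, ht.2.trans ha.1.2.le⟩ ⟨ha.1.1.le, ha.1.2.le⟩ ht.2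
    have h2 := quantile_le (P := P) hM hX (ht.2.trans ha.1.2.le)
    simp only
    rw [marginalFrom_of_le u (by linarith), marginal_of_pos u (by linarith)]
  dara := fun _ _ _ hx hxy hd => marginalFrom_mul_le hu hAu hWM hu0 hx hxy hd

end Problem

end RDU

/-! ### Assembly of the four cases. -/

theorem mainTheorem9 {Ω : Type*} [MeasurableSpace Ω] (P : Measure Ω) [IsProbabilityMeasure P]
    (X : Ω → ℝ) (M W₀ ρ W : ℝ) (u T : ℝ → ℝ)
    (hM : 0 < M) (hX : RDU.IsLoss P X M) (hρ : -1 < ρ)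
    -- `W = W₀ - (1+ρ)E[X]`, and the insured cannot go bankrupt
    (hW : W = W₀ - (1 + ρ) * ∫ ω, X ω ∂P) (hWM : 0 ≤ W - M)
    (hT : RDU.IsInverseS T)
    (hu : RDU.IsStrictlyConcaveUtility u)
    -- differentiability of `u` at the end point `0` is only needed if zero wealth can occur
    (hu0 : W = M → DifferentiableWithinAt ℝ u (Ici 0) 0)
    (hAu : StrictAntiOn (RDU.arrowPratt u) (Ioi 0))
    (hAT : ∀ a, RDU.IsTurningPoint T a → ∀ z ∈ Ioc 0 a,
      DifferentiableAt ℝ (RDU.quantile P X) z →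
      RDU.arrowPratt u (W - RDU.quantile P X z) * deriv (RDU.quantile P X) z
        < RDU.arrowPratt T z) :
    ∃ a c la lc : ℝ,
      RDU.IsTheOnly (RDU.IsTurningPoint T) a ∧
      RDU.IsTheOnly (RDU.IsUnitPoint T a) c ∧
      RDU.IsTheOnly (RDU.IsZeroOfH u T (RDU.quantile P X)
        (W + (1 + ρ) * RDU.retained (RDU.quantile P X) a) a c) la ∧
      RDU.IsTheOnly (RDU.IsZeroOfH u T (RDU.quantile P X)
        (W + (1 + ρ) * RDU.retained (RDU.quantile P X) c) a c) lc ∧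
      ∀ Δ : ℝ,
        (Δ = 0 → RDU.IsOptimal P X M Δ (W + (1 + ρ) * Δ) u T (fun _ => 0)) ∧
        (0 < Δ → Δ ≤ RDU.retained (RDU.quantile P X) la →
          RDU.ThreefoldOptimal P X M Δ (W + (1 + ρ) * Δ) a u T) ∧
        (RDU.retained (RDU.quantile P X) la < Δ → Δ < RDU.retained (RDU.quantile P X) lc →
          (∃ p ∈ Ioo la lc, RDU.retained (RDU.quantile P X) p = Δ) ∧
          ∀ p ∈ Ioo la lc, RDU.retained (RDU.quantile P X) p = Δ →
            (RDU.gFun u T (RDU.quantile P X) W ρ p < 0 →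
              RDU.ThreefoldOptimal P X M Δ (W + (1 + ρ) * Δ) a u T) ∧
            (0 ≤ RDU.gFun u T (RDU.quantile P X) W ρ p →
              RDU.DeductibleOptimal P X M Δ (W + (1 + ρ) * Δ) u T (Ico 0 lc))) ∧
        (RDU.retained (RDU.quantile P X) lc ≤ Δ → Δ ≤ ∫ ω, X ω ∂P →
          RDU.DeductibleOptimal P X M Δ (W + (1 + ρ) * Δ) u T (Icc lc 1)) := by

  have hu0' : W - M = 0 → DifferentiableWithinAt ℝ u (Ici 0) 0 := fun e => hu0 (by linarith)
  obtain ⟨a, ha, hanti, hda⟩ := hT.exists_turningPoint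
  obtain ⟨c, hc⟩ := ha.exists_unitPoint hT
  have h := RDU.isRegular_marginalFrom hM hX hWM hT hu hu0' hAu ha hanti hda hc.1 (hAT a ha)
  have hE := RDU.integral_quantile hM hX
  have hρ' : 0 < 1 + ρ := by linarith
  set Q := RDU.quantile P X with hQ
  set v := RDU.marginalFrom u (W - M) with hv
  have h0I : (0 : ℝ) ∈ Icc (0 : ℝ) 1 := left_mem_Icc.2 zero_le_one
  have hcI : c ∈ Icc (0 : ℝ) 1 := ⟨h.a_mem.1.trans hc.1.1.1.le, hc.1.1.2.le⟩
  have hac : Icc a c ⊆ Icc (0 : ℝ) 1 := Icc_subset_Icc h.a_mem.1 hcI.2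
  have hIco : ∀ {z}, z ∈ Icc a c → z ∈ Ico a 1 := fun hz => ⟨hz.1, hz.2.trans_lt hc.1.1.2⟩
  have hrm := RDU.monotoneOn_retained h.ac h.mono
  have hr0 : RDU.retained Q 0 = 0 := RDU.retained_zero h.zero
  have hrnn : ∀ z ∈ Icc (0 : ℝ) 1, 0 ≤ RDU.retained Q z := fun z hz => by
    rw [← hr0]; exact hrm h0I hz hz.1
  have hWle : ∀ {Δ}, 0 ≤ Δ → W ≤ W + (1 + ρ) * Δ := fun hΔ => by nlinarith
  have hWlt : ∀ {Δ}, 0 < Δ → W < W + (1 + ρ) * Δ := fun hΔ => by nlinarith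
  have hwmono : ∀ {Δ Δ'}, Δ ≤ Δ' → W + (1 + ρ) * Δ ≤ W + (1 + ρ) * Δ' := fun hΔ => by nlinarith
  -- Positive wealth at `a` even when `W = M`: either `Q a = 0` and `W ≥ M > 0`, or `Q a > 0`, which
  -- forces `Δ > 0`.
  have hwa : ∀ Δ, RDU.retained Q a ≤ Δ → 0 < W + (1 + ρ) * Δ - Q a := fun Δ hΔ => by
    rcases eq_or_lt_of_le (h.nonneg h.a_mem) with e | hpos
    · linarith [hWle ((hrnn a h.a_mem).trans hΔ)]
    · have h1 := RDU.le_retained_sub h.ac h.mono le_rfl h.a_mem.1 h.a_mem.2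
      rw [h.zero, hr0, sub_zero, sub_zero] at h1
      have h2 := mul_pos hpos (sub_pos.2 ha.1.2)
      linarith [hWlt (show 0 < Δ by linarith), h.le_M a h.a_mem]
  obtain ⟨la, hla, hka, hla'⟩ := RDU.exists_isTheOnly_isZeroOfH h
    (hWle (hrnn a h.a_mem)) (hwa _ le_rfl)
  obtain ⟨lc, hlc, hkc, hlc'⟩ := RDU.exists_isTheOnly_isZeroOfH h
    (hWle (hrnn c hcI)) (hwa _ (hrm h.a_mem hcI hc.1.1.1.le))
  have h0a : (0 : ℝ) ∈ Icc 0 a := ⟨le_rfl, h.a_mem.1⟩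
  refine ⟨a, c, la, lc, ⟨ha, fun y hy => ha.unique hy⟩, hc, hla', hlc', fun Δ => ⟨?_, ?_, ?_, ?_⟩⟩
  · rintro rfl
    rw [mul_zero, add_zero]
    exact RDU.isOptimal_zero hM hX hWM hT hu hu0'
  · intro hΔ hΔla
    have hw := hWlt hΔ
    have hwa' : 0 < W + (1 + ρ) * Δ - Q a := by linarith [h.le_M a h.a_mem]
    obtain ⟨l, hl, hl0⟩ := h.exists_kFun_eq_zero hw.le hwa' h0a
    refine RDU.threefoldOptimal hM hX hWM hu h hw hΔ.le (hIco hl) hl0.le ?_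
    -- With `l` the zero at wealth `W_Δ`, the goal is `Δ ≤ retained Q l`. Small `Δ` is covered by `a
    -- ≤ l`; otherwise `W_Δ` is at least the wealth defining `la`, and decreasing risk aversion
    -- gives `la ≤ l`.
    rcases le_total Δ (RDU.retained Q a) with hle | hle
    · exact hle.trans (hrm h.a_mem (hac hl) hl.1)
    · refine hΔla.trans (hrm (hac hla) (hac hl) ?_)
      have hk := h.kFun_nonneg_of_le (z := l) (hWle (hrnn a h.a_mem)) (hwmono hle)
        ⟨h.a_mem.1.trans hl.1, (hIco hl).2⟩ hl0.ge
      exact ((h.kFun_strictMonoOn _ h0a).le_iff_le (hIco hla) (hIco hl)).1 (hka.trans_le hk)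
  · intro hΔa hΔc
    have hΔ : 0 < Δ := (hrnn la (hac hla)).trans_lt hΔa
    have hw := hWlt hΔ
    have hlac : la ≤ lc := by
      by_contra! hlt
      linarith [hrm (hac hlc) (hac hla) hlt.le]
    refine ⟨intermediate_value_Ioo hlac ((RDU.continuousOn_retained h.ac).mono
      (Icc_subset_Icc (hac hla).1 (hac hlc).2)) ⟨hΔa, hΔc⟩, fun p hp hpΔ => ?_⟩
    have hpI : p ∈ Ico a 1 := ⟨hla.1.trans hp.1.le, hp.2.trans (hIco hlc).2⟩
    have hp01 : p ∈ Ico (0 : ℝ) 1 := ⟨h.a_mem.1.trans hpI.1, hpI.2⟩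
    have hg : RDU.gFun u T Q W ρ p = RDU.kFun v T Q (W + (1 + ρ) * Δ) 0 p := by
      rw [RDU.gFun, hpΔ]
      exact RDU.integral_eq_kFun h hw.le le_rfl hp01.1 hp01.2.le
    rw [hg]
    refine ⟨fun hneg => ?_, fun hnn => ⟨⟨p, ⟨hp01.1, hp.2⟩, ?_⟩, fun f hf hfΔ => ?_⟩⟩
    · exact RDU.threefoldOptimal hM hX hWM hu h hw hΔ.le hpI hneg.le hpΔ.ge
    · rw [RDU.integral_deductible hM hX (Ico_subset_Icc_self hp01), hpΔ]
    · have hf01 : f ∈ Ico (0 : ℝ) 1 := ⟨hf.1, hf.2.trans (hIco hlc).2⟩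
      have hfr := hfΔ
      rw [RDU.integral_deductible hM hX (Ico_subset_Icc_self hf01)] at hfr
      -- Every `f` with the right mean yields the same function as `p`, so optimality need only be
      -- checked at `p`, which lies in `[a, 1)`.
      have hQfp := RDU.eq_of_retained_eq h.ac h.mono hf01 hp01 (hfr.trans hpΔ.symm)
      rw [RDU.deductible_congr hM hX (Ico_subset_Icc_self hf01) (Ico_subset_Icc_self hp01) hQfp]
        at hfΔ ⊢
      exact RDU.isOptimal_deductible hM hX hWM hu h hw hpI hnn hfΔ
  · intro hΔc hΔE
    have hlc1 : lc ≤ 1 := (hac hlc).2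
    constructor
    · have hr1 : RDU.retained Q 1 = ∫ ω, X ω ∂P := by rw [← hE, RDU.retained]; ring
      obtain ⟨f, hf, hfΔ⟩ := intermediate_value_Icc hlc1 ((RDU.continuousOn_retained h.ac).mono
        (Icc_subset_Icc_left (hac hlc).1)) (show Δ ∈ Icc _ _ from ⟨hΔc, hr1 ▸ hΔE⟩)
      exact ⟨f, hf, by
        rw [RDU.integral_deductible hM hX ⟨(hac hlc).1.trans hf.1, hf.2⟩, hfΔ]⟩
    · intro f hf hfΔ
      have hf01 : f ∈ Icc (0 : ℝ) 1 := ⟨(hac hlc).1.trans hf.1, hf.2⟩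
      rcases eq_or_lt_of_le hf.2 with e | hf1
      · subst e
        rw [← hfΔ]
        exact RDU.isOptimal_quantile hM hX _
      have hfr := hfΔ
      rw [RDU.integral_deductible hM hX hf01] at hfr
      have hfI : f ∈ Ico a 1 := ⟨hlc.1.trans hf.1, hf1⟩
      -- `Δ = 0` can occur here if `Q` is flat near `0`; then the deductible function is zero.
      rcases eq_or_lt_of_le ((hrnn lc (hac hlc)).trans hΔc) with e | hΔ
      · have hQf : Q f = Q 0 := RDU.eq_of_retained_eq h.ac h.mono ⟨hf01.1, hf1⟩
          ⟨le_rfl, zero_lt_one⟩ (by rw [hfr, hr0, e])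
        have hD : RDU.deductible Q f = fun _ => 0 := by
          rw [RDU.deductible_congr hM hX hf01 h0I hQf,
            RDU.deductible_eq_threefold fun t ht => RDU.quantile_of_nonpos ht]
          funext t
          simp only [RDU.threefold, sub_self]
          split_ifs <;> rfl
        rw [hD, ← e, mul_zero, add_zero]
        exact RDU.isOptimal_zero hM hX hWM hT hu hu0'
      refine RDU.isOptimal_deductible hM hX hWM hu h (hWlt hΔ) hfI ?_ hfΔ
      have hmono := (h.kFun_strictMonoOn (W + (1 + ρ) * Δ) h0a).monotoneOn
      -- Below `Δ(c)` the sign at `lc` passes down to wealth `W_Δ` and then right to `f`. Above it,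
      -- `f ≥ c`, where `k ≥ 0` at any wealth, except for `f ≤ c` with `Δ = Δ(c)`.
      rcases le_total Δ (RDU.retained Q c) with hle | hle
      · refine le_trans ?_ (hmono (hIco hlc) hfI hf.1)
        exact h.kFun_nonneg_of_le (hWlt hΔ).le (hwmono hle) ⟨(hac hlc).1, (hIco hlc).2⟩ hkc.ge
      · rcases le_total c f with hcf | hfc
        · exact (h.kFun_unit_nonneg _ h0a).trans
            (hmono ⟨hc.1.1.1.le, hc.1.1.2⟩ hfI hcf)
        · have : Δ = RDU.retained Q c := le_antisymm (hfr ▸ hrm hf01 hcI hfc) hle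
          rw [this]
          rw [this] at hmono
          exact hkc.ge.trans (hmono (hIco hlc) hfI hf.1)
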